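/- A temporal graph $(G,\lambda)$ consists of a finite undirected simple graph $G=(V,E)$ and a labeling $\lambda:E\to\mathbb N$. A proper orientation of it is a set $F$ of ordered pairs containing exactly one of $uv$, $vu$ for every edge $\{u,v\}\in E$ and nothing else. A proper orientation $F$ is strongly temporally transitive if, whenever $uv,vw\in F$ with $\lambda(\{v,w\})\ge\lambda(\{u,v\})$, we have $uw\in F$ and $\lambda(\{u,w\})>\lambda(\{v,w\})$; it is strongly strictly temporally transitive if the same is required only when $\lambda(\{v,w\})>\lambda(\{u,v\})$. Strong TTO (respectively Strong Strict TTO) is the problem of deciding whether a given temporal graph admits a strongly (respectively strongly strictly) temporally transitive orientation. **Theorem.** Strong TTO and Strong Strict TTO are solvable in polynomial time. That is, for each of the two problems there are a program of a random access machine (finitely many registers and arrays holding natural numbers; copying, constants, addition, truncated subtraction, indirect addressing, comparisons, each at unit cost) and a polynomial $f$ such that, on every temporal graph with $V=\{0,\dots,n-1\}$, given as $n$ followed by a list of the triples $(u,v,\lambda(\{u,v\}))$, one for each edge $\{u,v\}$, in any order, the program halts after at most $f(N)$ steps with the correct yes/no answer, where $N$ is the number of entries of the input plus their total number of binary digits.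 Moreover, for both variants and every temporal graph the constraints are expressible in 2SAT, with one Boolean variable $x_{uv}$ for each ordered pair $(u,v)\in V\times V$, set to true if and only if $uv\in F$: (a) for any three distinct vertices $u,v,w$ with $\{u,v\},\{v,w\}\in E$ (so that they span a triangle or an induced 2-path) there is a 2CNF formula in the variables indexed by pairs from $\{u,v,w\}$ which a proper orientation $F$ satisfies if and only if $F$ satisfies the transitivity condition of the variant for all directed 2-paths within $\{u,v,w\}$; (b) there is a 2CNF formula whose satisfying assignments are exactly the strongly (respectively strongly strictly) temporally transitive orientations of the temporal graph; in particular, the answer to the decision problem is yes if and only if this formula is satisfiable. -/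

import Mathlib

/-! ### Temporal graphs and their strong orientations -/

/-- A temporal graph on the vertex set `V`: an undirected simple graph with one time-label per
edge. -/
structure TemporalGraph (V : Type*) where
  graph : SimpleGraph V
  label : graph.edgeSet → ℕ

/-- The two strong variants of temporal transitivity. -/
inductive Variant where
  | strong
  | strongStrict

/-- The condition that the variant puts on the labels `t₁` of `uv` and `t₂` of `vw` for the
directed 2-path `u v w` to be constrained. -/
def Variant.Before : Variant → ℕ → ℕ → Prop
  | .strong, t₁, t₂ => t₁ ≤ t₂
  | .strongStrict, t₁, t₂ => t₁ < t₂

namespace TemporalGraph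

variable {V : Type*}

/-- `({u, v}, t)` is a time-edge. -/
def TimeEdge (T : TemporalGraph V) (u v : V) (t : ℕ) : Prop :=
  ∃ h : T.graph.Adj u v, T.label ⟨s(u, v), h⟩ = t

/-- `F` is a proper orientation of the edge set: it consists of orientations of edges and contains
exactly one of the two orientations of every edge. -/
def IsProperOrientation (T : TemporalGraph V) (F : Set (V × V)) : Prop :=
  (∀ u v, (u, v) ∈ F → T.graph.Adj u v) ∧
  (∀ u v, T.graph.Adj u v → Xor ((u, v) ∈ F) ((v, u) ∈ F))

/-- `(uv, t)` is an oriented time-edge with respect to `F`. -/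
def OrientedTimeEdge (T : TemporalGraph V) (F : Set (V × V)) (u v : V) (t : ℕ) : Prop :=
  (u, v) ∈ F ∧ T.TimeEdge u v t

/-- The (strict) strong temporal transitivity condition for all directed 2-paths of `F` within the
vertex set `S`: if `(uv, t₁)` and `(vw, t₂)` are oriented time-edges with `t₁ ≤ t₂`
(strict variant: `t₁ < t₂`) then there is an oriented time-edge `(uw, t₃)` with `t₃ > t₂`. -/
def StronglyTransitiveOn (T : TemporalGraph V) (α : Variant) (F : Set (V × V)) (S : Set V) :
    Prop :=
  ∀ u ∈ S, ∀ v ∈ S, ∀ w ∈ S, ∀ t₁ t₂ : ℕ,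
    T.OrientedTimeEdge F u v t₁ → T.OrientedTimeEdge F v w t₂ → α.Before t₁ t₂ →
      ∃ t₃ : ℕ, t₂ < t₃ ∧ T.OrientedTimeEdge F u w t₃

/-- `F` is a strongly (resp. strongly strictly) temporally transitive orientation. -/
def IsStrongOrientation (T : TemporalGraph V) (α : Variant) (F : Set (V × V)) : Prop :=
  T.IsProperOrientation F ∧ T.StronglyTransitiveOn α F Set.univ

end TemporalGraph

/-! ### The decision problems and the encoding of their instances -/

/-- Instances: temporal graphs on a vertex set `{0, …, n - 1}`. -/
abbrev TemporalInstance := Σ n : ℕ, TemporalGraph (Fin n)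

/-- The decision problem Strong TTO (resp. Strong Strict TTO). -/
def StrongTTO (α : Variant) (I : TemporalInstance) : Prop :=
  ∃ F : Set (Fin I.1 × Fin I.1), I.2.IsStrongOrientation α F

/-- `L` lists all time-edges, each edge exactly once, in any order and with its endpoints in any
order. -/
def IsTimeEdgeList {n : ℕ} (T : TemporalGraph (Fin n)) (L : List (Fin n × Fin n × ℕ)) : Prop :=
  (L.map fun e => s(e.1, e.2.1)).Nodup ∧
  ∀ (u v : Fin n) (t : ℕ), T.TimeEdge u v t ↔ (u, v, t) ∈ L ∨ (v, u, t) ∈ L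

/-- `l` is an encoding of the instance: the number of vertices, followed by three numbers
`u, v, t` for each time-edge. -/
def EncodesInstance (I : TemporalInstance) (l : List ℕ) : Prop :=
  ∃ L : List (Fin I.1 × Fin I.1 × ℕ), IsTimeEdgeList I.2 L ∧
    l = I.1 :: L.flatMap fun e => [(e.1 : ℕ), (e.2.1 : ℕ), e.2.2]

/-! ### Random access machine programs and polynomial time

A program is a fixed finite text, so it uses finitely many registers and finitely many arrays. The
only arithmetic is addition and truncated subtraction, so in `k` steps numbers grow by at most `k`
bits, and unit-cost time is polynomially related to Turing machine time. -/

namespace RAM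

/-- The state of the machine: registers and arrays, all holding natural numbers. -/
structure State where
  reg : ℕ → ℕ
  arr : ℕ → ℕ → ℕ

/-- Tests on the contents of two registers. -/
inductive Test where
  | lt (x y : ℕ)
  | eq (x y : ℕ)

def Test.Holds : Test → State → Prop
  | .lt x y, s => s.reg x < s.reg y
  | .eq x y, s => s.reg x = s.reg y

/-- Programs; `x`, `y`, `z`, `i` are names of registers and `a` is the name of an array. -/
inductive Prog where
  | skip
  /-- `x := c` -/
  | const (x c : ℕ)
  /-- `x := y` -/
  | copy (x y : ℕ)
  /-- `x := y + z` -/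
  | add (x y z : ℕ)
  /-- `x := y - z` (truncated) -/
  | sub (x y z : ℕ)
  /-- `x := a[i]` -/
  | load (x a i : ℕ)
  /-- `a[i] := x` -/
  | store (a i x : ℕ)
  | seq (p q : Prog)
  | ite (b : Test) (p q : Prog)
  | loop (b : Test) (p : Prog)

def State.setReg (s : State) (x c : ℕ) : State :=
  { s with reg := Function.update s.reg x c }

def State.setArr (s : State) (a i c : ℕ) : State :=
  { s with arr := Function.update s.arr a (Function.update (s.arr a) i c) }

/-- `Exec p s k s'`: started in state `s`, the program `p` halts in state `s'` after exactly `k`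
steps. Every elementary instruction and every evaluation of a test is one step. -/
inductive Exec : Prog → State → ℕ → State → Prop where
  | skip (s : State) : Exec .skip s 1 s
  | const (x c : ℕ) (s : State) : Exec (.const x c) s 1 (s.setReg x c)
  | copy (x y : ℕ) (s : State) : Exec (.copy x y) s 1 (s.setReg x (s.reg y))
  | add (x y z : ℕ) (s : State) : Exec (.add x y z) s 1 (s.setReg x (s.reg y + s.reg z))
  | sub (x y z : ℕ) (s : State) : Exec (.sub x y z) s 1 (s.setReg x (s.reg y - s.reg z))
  | load (x a i : ℕ) (s : State) : Exec (.load x a i) s 1 (s.setReg x (s.arr a (s.reg i)))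
  | store (a i x : ℕ) (s : State) : Exec (.store a i x) s 1 (s.setArr a (s.reg i) (s.reg x))
  | seq {p q : Prog} {s s' s'' : State} {k l : ℕ} :
      Exec p s k s' → Exec q s' l s'' → Exec (.seq p q) s (k + l) s''
  | ite_true {b : Test} {p q : Prog} {s s' : State} {k : ℕ} :
      b.Holds s → Exec p s k s' → Exec (.ite b p q) s (k + 1) s'
  | ite_false {b : Test} {p q : Prog} {s s' : State} {k : ℕ} :
      ¬ b.Holds s → Exec q s k s' → Exec (.ite b p q) s (k + 1) s'
  | loop_done {b : Test} {p : Prog} {s : State} :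
      ¬ b.Holds s → Exec (.loop b p) s 1 s
  | loop_step {b : Test} {p : Prog} {s s' s'' : State} {k l : ℕ} :
      b.Holds s → Exec p s k s' → Exec (.loop b p) s' l s'' → Exec (.loop b p) s (k + l + 1) s''

/-- The machine is deterministic. -/
theorem Exec.deterministic {p : Prog} {s s₁ s₂ : State} {k₁ k₂ : ℕ}
    (h₁ : Exec p s k₁ s₁) (h₂ : Exec p s k₂ s₂) : k₁ = k₂ ∧ s₁ = s₂ := by
  induction h₁ generalizing k₂ s₂ with
  | seq _ _ ih ih' =>
    cases h₂ with
    | seq a b =>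
      obtain ⟨rfl, rfl⟩ := ih a
      obtain ⟨rfl, rfl⟩ := ih' b
      exact ⟨rfl, rfl⟩
  | ite_true hb _ ih =>
    cases h₂ with
    | ite_true _ a => obtain ⟨rfl, rfl⟩ := ih a; exact ⟨rfl, rfl⟩
    | ite_false hn _ => exact absurd hb hn
  | ite_false hn _ ih =>
    cases h₂ with
    | ite_true hb _ => exact absurd hb hn
    | ite_false _ a => obtain ⟨rfl, rfl⟩ := ih a; exact ⟨rfl, rfl⟩
  | loop_done hn =>
    cases h₂ with
    | loop_done _ => exact ⟨rfl, rfl⟩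
    | loop_step hb _ _ => exact absurd hb hn
  | loop_step hb _ _ ih ih' =>
    cases h₂ with
    | loop_done hn => exact absurd hb hn
    | loop_step _ a b =>
      obtain ⟨rfl, rfl⟩ := ih a
      obtain ⟨rfl, rfl⟩ := ih' b
      exact ⟨rfl, rfl⟩
  | _ => cases h₂; exact ⟨rfl, rfl⟩

/-- The initial state: the input is in array `0` and its number of entries in register `0`;
everything else is zero. -/
def init (l : List ℕ) : State where
  reg x := if x = 0 then l.length else 0
  arr a i := if a = 0 then l.getD i 0 else 0

/-- The size of an input: the total number of binary digits, plus one separator per entry. -/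
def inputSize (l : List ℕ) : ℕ := (l.map fun c => Nat.size c + 1).sum

/-- A decision problem `Q` is solvable in polynomial time: one program, on every encoding of every
instance, halts within a number of steps polynomial in the input size, with answer `1` in register
`0` on the yes-instances and answer `0` on the no-instances. -/
def SolvableInPolyTime {ι : Type*} (enc : ι → List ℕ → Prop) (Q : ι → Prop) : Prop :=
  ∃ (p : Prog) (f : Polynomial ℕ), ∀ (I : ι) (l : List ℕ), enc I l →
    ∃ (k : ℕ) (s : State), Exec p (init l) k s ∧ k ≤ f.eval (inputSize l) ∧
      (Q I → s.reg 0 = 1) ∧ (¬ Q I → s.reg 0 = 0)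

end RAM

/-! ### 2SAT -/

/-- A 2CNF formula over the variables `X`: a finite conjunction of clauses with two literals; the
literal `(x, true)` is `x` and `(x, false)` is its negation. -/
abbrev TwoCNF (X : Type*) := List ((X × Bool) × (X × Bool))

/-- The assignment satisfies the formula. -/
def TwoCNF.Sat {X : Type*} (φ : TwoCNF X) (τ : X → Prop) : Prop :=
  ∀ c ∈ φ, (τ c.1.1 ↔ c.1.2 = true) ∨ (τ c.2.1 ↔ c.2.2 = true)

/-- All variables of the formula lie in `Y`. -/
def TwoCNF.VarsIn {X : Type*} (φ : TwoCNF X) (Y : Set X) : Prop :=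
  ∀ c ∈ φ, c.1.1 ∈ Y ∧ c.2.1 ∈ Y

/-! ### Conflicts: the binary constraints of a temporal graph -/

namespace TemporalGraph

variable {V : Type*} {T : TemporalGraph V}

/-! Transitivity is an implication "`uv` and `vw` force `uw`", so at first sight it needs three
literals. The labels remove the third. If no edge `uw` with a label above that of `vw` exists, then
`uv` and `vw` simply cannot both be chosen. If it exists but is oriented `wu`, then `vw`, `wu` is a
directed path with strictly increasing labels whose closing edge `vu` has too small a label, so this
second path is already forbidden. For proper orientations, transitivity thus means avoiding all
pairs of arcs in `Conflict` (`IsProperOrientation.stronglyTransitiveOn_iff`). Conflicts are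
2-clauses, and so are the conditions for being proper; this gives both 2SAT statements.

For the algorithm the literals are the oriented edges and negation is reversal, so properness is
built in. By the classical criterion a 2CNF is satisfiable iff no literal both implies and is
implied by its negation; `exists_assignment_of_transitive` builds the assignment by Zorn's lemma,
and the implication closure is computed by Warshall's algorithm (`exists_assignment_iff_warshall`).
`IsLiteralTable.exists_orientation_iff` transfers this to orientations. The machine program builds
the table and the implication matrix, closes the matrix and inspects the pairs of opposite literals.
Its loops are verified by invariants that carry step bounds (`Runs.forProg`). -/

theorem TimeEdge.adj {u v : V} {t : ℕ} (h : T.TimeEdge u v t) : T.graph.Adj u v := h.1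

theorem TimeEdge.symm {u v : V} {t : ℕ} (h : T.TimeEdge u v t) : T.TimeEdge v u t := by
  obtain ⟨h, rfl⟩ := h
  refine ⟨h.symm, ?_⟩
  congr 2
  exact Sym2.eq_swap

theorem TimeEdge.unique {u v : V} {t t' : ℕ} (h : T.TimeEdge u v t) (h' : T.TimeEdge u v t') :
    t = t' := by
  obtain ⟨_, rfl⟩ := h
  obtain ⟨_, rfl⟩ := h'
  rfl

theorem exists_timeEdge {u v : V} (h : T.graph.Adj u v) : ∃ t, T.TimeEdge u v t := ⟨_, h, rfl⟩

/-- No strong orientation contains both `uv` and `vw`. -/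
def Conflict (T : TemporalGraph V) (α : Variant) (u v w : V) : Prop :=
  u ≠ w ∧ ∃ t₁ t₂, T.TimeEdge u v t₁ ∧ T.TimeEdge v w t₂ ∧ α.Before t₁ t₂ ∧
    ¬ ∃ t₃, t₂ < t₃ ∧ T.TimeEdge u w t₃

theorem _root_.Variant.Before.le {α : Variant} {a b : ℕ} (h : α.Before a b) : a ≤ b := by
  cases α
  · exact h
  · exact le_of_lt h

theorem _root_.Variant.before_of_lt (α : Variant) {a b : ℕ} (h : a < b) : α.Before a b := by
  cases α
  · exact le_of_lt h
  · exact h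

/-- The only failure that is not itself a conflict is an edge `uw` with a large label but oriented
`wu`. It produces the conflict `v, w, u` on the same three vertices, so the equivalence holds within
any `S`. -/
theorem IsProperOrientation.stronglyTransitiveOn_iff {α : Variant} {F : Set (V × V)}
    (hF : T.IsProperOrientation F) (S : Set V) :
    T.StronglyTransitiveOn α F S ↔
      ∀ u ∈ S, ∀ v ∈ S, ∀ w ∈ S, T.Conflict α u v w → ¬ ((u, v) ∈ F ∧ (v, w) ∈ F) := by
  constructor
  · rintro h u hu v hv w hw ⟨-, t₁, t₂, h₁, h₂, hb, hn⟩ ⟨huv, hvw⟩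
    obtain ⟨t₃, hlt, -, h₃⟩ := h u hu v hv w hw t₁ t₂ ⟨huv, h₁⟩ ⟨hvw, h₂⟩ hb
    exact hn ⟨t₃, hlt, h₃⟩
  · rintro h u hu v hv w hw t₁ t₂ ⟨huv, h₁⟩ ⟨hvw, h₂⟩ hb
    have not_both : ∀ a b, (a, b) ∈ F → (b, a) ∉ F := by
      intro a b hab hba
      rcases hF.2 a b (hF.1 a b hab) with ⟨-, h⟩ | ⟨-, h⟩
      · exact h hba
      · exact h hab
    have huw : u ≠ w := by
      rintro rfl
      exact not_both _ _ huv hvw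
    by_cases hex : ∃ t₃, t₂ < t₃ ∧ T.TimeEdge u w t₃
    · obtain ⟨t₃, hlt, h₃⟩ := hex
      refine ⟨t₃, hlt, ?_, h₃⟩
      by_contra hnot
      have hwu : (w, u) ∈ F := by
        rcases hF.2 u w h₃.adj with ⟨h, -⟩ | ⟨h, -⟩
        · exact absurd h hnot
        · exact h
      -- The path `v, w, u` has labels `t₂ < t₃`, and its closing edge `vu` has label `t₁ ≤ t₂`,
      -- which does not exceed `t₃`.
      refine h v hv w hw u hu ⟨h₁.adj.ne', t₂, t₃, h₂, h₃.symm, α.before_of_lt hlt, ?_⟩ ⟨hvw, hwu⟩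
      rintro ⟨t, ht, hvu⟩
      have := hvu.symm.unique h₁
      have := hb.le
      omega
    · exact absurd ⟨huv, hvw⟩ (h u hu v hv w hw ⟨huw, t₁, t₂, h₁, h₂, hb, hex⟩)

/-- The clauses forbidding the conflicts within `S`. -/
def conflictClauses (T : TemporalGraph V) (α : Variant) (S : Set V) :
    Set (((V × V) × Bool) × ((V × V) × Bool)) :=
  {c | ∃ u ∈ S, ∃ v ∈ S, ∃ w ∈ S, T.Conflict α u v w ∧ c = (((u, v), false), ((v, w), false))}

/-- The clauses expressing that an orientation is proper. -/
def properClauses (T : TemporalGraph V) : Set (((V × V) × Bool) × ((V × V) × Bool)) :=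
  -- A unit clause is written with its literal doubled.
  {c | ∃ u v, (¬ T.graph.Adj u v ∧ c = (((u, v), false), ((u, v), false))) ∨
    (T.graph.Adj u v ∧
      (c = (((u, v), true), ((v, u), true)) ∨ c = (((u, v), false), ((v, u), false))))}

theorem exists_twoCNF_of_finite {X : Type*} [Finite X] (C : Set ((X × Bool) × (X × Bool))) :
    ∃ φ : TwoCNF X, ∀ c, c ∈ φ ↔ c ∈ C :=
  ⟨C.toFinite.toFinset.toList, by simp⟩

theorem forall_conflictClauses_iff (α : Variant) (S : Set V) (F : Set (V × V)) :
    (∀ c ∈ T.conflictClauses α S, (c.1.1 ∈ F ↔ c.1.2 = true) ∨ (c.2.1 ∈ F ↔ c.2.2 = true)) ↔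
      ∀ u ∈ S, ∀ v ∈ S, ∀ w ∈ S, T.Conflict α u v w → ¬ ((u, v) ∈ F ∧ (v, w) ∈ F) := by
  constructor
  · intro h u hu v hv w hw hc
    have := h _ ⟨u, hu, v, hv, w, hw, hc, rfl⟩
    simp only [Bool.false_eq_true, iff_false] at this
    tauto
  · rintro h c ⟨u, hu, v, hv, w, hw, hc, rfl⟩
    have := h u hu v hv w hw hc
    simp only [Bool.false_eq_true, iff_false]
    tauto

theorem forall_properClauses_iff (F : Set (V × V)) :
    (∀ c ∈ T.properClauses, (c.1.1 ∈ F ↔ c.1.2 = true) ∨ (c.2.1 ∈ F ↔ c.2.2 = true)) ↔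
      T.IsProperOrientation F := by
  constructor
  · intro h
    constructor
    · intro u v huv
      by_contra hn
      have := h _ ⟨u, v, .inl ⟨hn, rfl⟩⟩
      simp [huv] at this
    · intro u v hadj
      have h₁ := h _ ⟨u, v, .inr ⟨hadj, .inl rfl⟩⟩
      have h₂ := h _ ⟨u, v, .inr ⟨hadj, .inr rfl⟩⟩
      simp only [iff_true, Bool.false_eq_true, iff_false] at h₁ h₂
      unfold Xor
      tauto
  · rintro h c ⟨u, v, ⟨hn, rfl⟩ | ⟨hadj, rfl | rfl⟩⟩
    · have := mt (h.1 u v) hn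
      simp [this]
    · have := h.2 u v hadj
      simp only [iff_true]
      unfold Xor at this
      tauto
    · have := h.2 u v hadj
      simp only [Bool.false_eq_true, iff_false]
      unfold Xor at this
      tauto

theorem exists_twoCNF_transitiveOn [Finite V] (T : TemporalGraph V) (α : Variant) (S : Set V) :
    ∃ ψ : TwoCNF (V × V), ψ.VarsIn (S ×ˢ S) ∧ ∀ F : Set (V × V), T.IsProperOrientation F →
      (ψ.Sat (fun e => e ∈ F) ↔ T.StronglyTransitiveOn α F S) := by
  obtain ⟨ψ, hψ⟩ := exists_twoCNF_of_finite (T.conflictClauses α S)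
  refine ⟨ψ, ?_, fun F hF => ?_⟩
  · intro c hc
    obtain ⟨u, hu, v, hv, w, hw, -, rfl⟩ := (hψ c).1 hc
    exact ⟨⟨hu, hv⟩, ⟨hv, hw⟩⟩
  · simp only [TwoCNF.Sat, hψ]
    rw [hF.stronglyTransitiveOn_iff, forall_conflictClauses_iff]

theorem exists_twoCNF_strongOrientation [Finite V] (T : TemporalGraph V) (α : Variant) :
    ∃ φ : TwoCNF (V × V), ∀ F : Set (V × V),
      φ.Sat (fun e => e ∈ F) ↔ T.IsStrongOrientation α F := by
  obtain ⟨φ, hφ⟩ :=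
    exists_twoCNF_of_finite (T.properClauses ∪ T.conflictClauses α Set.univ)
  refine ⟨φ, fun F => ?_⟩
  simp only [TwoCNF.Sat, hφ, Set.mem_union, or_imp, forall_and]
  rw [forall_properClauses_iff, forall_conflictClauses_iff]
  exact and_congr_right fun hF => (hF.stronglyTransitiveOn_iff _).symm

end TemporalGraph

/-! ### Satisfiability of 2CNF formulas through the implication relation -/

/-- A transitive implication relation closed under contraposition, in which no literal is
equivalent to its negation, is respected by some assignment. -/
theorem exists_assignment_of_transitive {X : Type*} (neg : X → X) (R : X → X → Prop)
    (hneg : ∀ x, neg (neg x) = x) (hne : ∀ x, neg x ≠ x)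
    (htrans : ∀ x y z, R x y → R y z → R x z) (hcontra : ∀ x y, R x y → R (neg y) (neg x))
    (hcons : ∀ x, ¬ (R x (neg x) ∧ R (neg x) x)) :
    ∃ τ : X → Prop, (∀ x, τ (neg x) ↔ ¬ τ x) ∧ ∀ x y, R x y → τ x → τ y := by
  obtain ⟨S, hS⟩ := zorn_subset
    {S : Set X | (∀ x y, R x y → x ∈ S → y ∈ S) ∧ ∀ x ∈ S, neg x ∉ S} (by
      intro c hc hchain
      refine ⟨⋃₀ c, ⟨?_, ?_⟩, fun s hs => Set.subset_sUnion_of_mem hs⟩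
      · rintro x y hxy ⟨s, hs, hx⟩
        exact ⟨s, hs, (hc hs).1 x y hxy hx⟩
      · rintro x ⟨s, hs, hx⟩ ⟨s', hs', hx'⟩
        rcases hchain.total hs hs' with h | h
        · exact (hc hs').2 x (h hx) hx'
        · exact (hc hs).2 x hx (h hx'))
  obtain ⟨hclosed, hdisj⟩ := hS.prop
  -- By maximality of `S`: adjoining `x` and all its consequences keeps the set closed, and by
  -- contraposition any clash in it would yield `R x (neg x)` or `neg x ∈ S`.
  have extend : ∀ x, ¬ R x (neg x) → neg x ∉ S → x ∈ S := by
    intro x hx hnx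
    have hsub : S ⊆ S ∪ {y | y = x ∨ R x y} := Set.subset_union_left
    refine hS.le_of_ge (y := S ∪ {y | y = x ∨ R x y}) ⟨?_, ?_⟩ hsub (.inr (.inl rfl))
    · rintro y z hyz (hy | rfl | hy)
      · exact .inl (hclosed y z hyz hy)
      · exact .inr (.inr hyz)
      · exact .inr (.inr (htrans _ _ _ hy hyz))
    · have hcon : ∀ y, R x y → R (neg y) (neg x) := fun y => hcontra x y
      have hcon' : ∀ y, R x (neg y) → R y (neg x) := fun y h => by
        have := hcontra _ _ h
        rwa [hneg] at this
      rintro y (hy | rfl | hy) (hy' | hy' | hy')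
      · exact hdisj y hy hy'
      · exact hnx (by rw [← hy', hneg]; exact hy)
      · exact hnx (hclosed _ _ (hcon' y hy') hy)
      · exact hnx hy'
      · exact hne _ hy'
      · exact hx hy'
      · exact hnx (hclosed _ _ (hcon y hy) hy')
      · exact hx (by rw [← hy', hneg, hy']; exact hy)
      · exact hx (htrans _ _ _ hy (hcon' y hy'))
  refine ⟨fun x => x ∈ S, fun x => ⟨fun h h' => hdisj x h' h, fun h => ?_⟩, hclosed⟩
  -- At most one of `x` and `neg x` implies its opposite, so `extend` applies to one of them.
  by_cases hx : R x (neg x)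
  · refine extend (neg x) ?_ (by rwa [hneg])
    rw [hneg]
    exact fun h' => hcons x ⟨hx, h'⟩
  · by_contra hn
    exact h (extend x hx hn)

/-! ### Warshall's algorithm as an operation on relations -/

/-- `Warshall R k x y`: there is an `R`-path from `x` to `y` with all intermediate vertices below
`k`. -/
def Warshall (R : ℕ → ℕ → Prop) : ℕ → ℕ → ℕ → Prop
  | 0 => R
  | k + 1 => fun x y => Warshall R k x y ∨ (Warshall R k x k ∧ Warshall R k k y)

theorem Warshall.of_base {R : ℕ → ℕ → Prop} {x y : ℕ} (h : R x y) (k : ℕ) : Warshall R k x y := by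
  induction k with
  | zero => exact h
  | succ k ih => exact .inl ih

/-- Concatenate the two paths; if both pass through the newly allowed vertex, cut out the detour
between the two visits. At `k = M` this is transitivity through all vertices below `M`. -/
theorem Warshall.trans_of_lt (R : ℕ → ℕ → Prop) (k : ℕ) :
    ∀ z < k, ∀ x y, Warshall R k x z → Warshall R k z y → Warshall R k x y := by
  induction k with
  | zero => simp
  | succ k ih =>
    intro z hz x y
    rcases Nat.lt_succ_iff_lt_or_eq.1 hz with hz | rfl
    · have ih := ih z hz
      simp only [Warshall]
      rintro (h₁ | ⟨h₁, h₂⟩) (h₃ | ⟨h₃, h₄⟩)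
      · exact .inl (ih _ _ h₁ h₃)
      · exact .inr ⟨ih _ _ h₁ h₃, h₄⟩
      · exact .inr ⟨h₁, ih _ _ h₂ h₃⟩
      · exact .inr ⟨h₁, h₄⟩
    · simp only [Warshall]
      tauto

/-- `Warshall R k` is contained in every relation that is transitive on `{0, …, M - 1}` and
contains `R` there. -/
theorem Warshall.minimal {R S : ℕ → ℕ → Prop} {M : ℕ}
    (hRS : ∀ x < M, ∀ y < M, R x y → S x y)
    (hS : ∀ x < M, ∀ y < M, ∀ z < M, S x y → S y z → S x z) (k : ℕ) (hk : k ≤ M) :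
    ∀ x < M, ∀ y < M, Warshall R k x y → S x y := by
  induction k with
  | zero => exact hRS
  | succ k ih =>
    have ih := ih (by omega)
    rintro x hx y hy (h | ⟨h₁, h₂⟩)
    · exact ih x hx y hy h
    · exact hS x hx k hk y hy (ih x hx k hk h₁) (ih k hk y hy h₂)

/-- The implication relation of the constraints `bad x y`, read as `¬ (x ∧ y)`. -/
def Implies (M : ℕ) (N : ℕ → ℕ) (bad : ℕ → ℕ → Prop) (x y : ℕ) : Prop :=
  ∃ a < M, ∃ b < M, bad a b ∧ ((x = a ∧ y = N b) ∨ (x = b ∧ y = N a))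

/-- The 2SAT criterion for literals `0, …, M - 1` with negation `N`. -/
theorem exists_assignment_iff_warshall {M : ℕ} {N : ℕ → ℕ} (bad : ℕ → ℕ → Prop)
    (hlt : ∀ x < M, N x < M) (hneg : ∀ x < M, N (N x) = x) (hne : ∀ x < M, N x ≠ x) :
    (∃ τ : ℕ → Prop, (∀ x < M, τ (N x) ↔ ¬ τ x) ∧
      ∀ x < M, ∀ y < M, bad x y → ¬ (τ x ∧ τ y)) ↔
    ∀ x < M, ¬ (Warshall (Implies M N bad) M x (N x) ∧ Warshall (Implies M N bad) M (N x) x) := by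
  have trans := Warshall.trans_of_lt (Implies M N bad) M
  constructor
  · rintro ⟨τ, hτ, hbad⟩ x hx ⟨h₁, h₂⟩
    -- A satisfying assignment respects each single implication, and "`τ x → τ y`" is transitive, so
    -- it respects the whole closure.
    have resp := Warshall.minimal (R := Implies M N bad) (S := fun x y => τ x → τ y) (M := M)
      (by
        rintro x hx y hy ⟨a, ha, b, hb, hab, ⟨rfl, rfl⟩ | ⟨rfl, rfl⟩⟩ h
        · exact (hτ b hb).2 fun h' => hbad _ ha _ hb hab ⟨h, h'⟩
        · exact (hτ a ha).2 fun h' => hbad _ ha _ hb hab ⟨h', h⟩)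
      (fun _ _ _ _ _ _ h h' => h' ∘ h) M le_rfl
    have h₁ := resp _ hx _ (hlt x hx) h₁
    have h₂ := resp _ (hlt x hx) _ hx h₂
    have := hτ x hx
    tauto
  · intro h
    -- The reversed, negated closure is transitive and contains the base implications, because each
    -- clause contributes both contrapositives; hence it contains the closure.
    have contra := Warshall.minimal (R := Implies M N bad) (M := M)
      (S := fun x y => Warshall (Implies M N bad) M (N y) (N x))
      (by
        rintro x hx y hy ⟨a, ha, b, hb, hab, ⟨rfl, rfl⟩ | ⟨rfl, rfl⟩⟩
        · exact .of_base ⟨_, ha, b, hb, hab, .inr ⟨hneg b hb, rfl⟩⟩ _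
        · exact .of_base ⟨a, ha, _, hb, hab, .inl ⟨hneg a ha, rfl⟩⟩ _)
      (fun x _ y hy z _ h h' => trans _ (hlt y hy) _ _ h' h) M le_rfl
    -- On `Fin M` the involution and the transitivity hold without range conditions.
    obtain ⟨τ, hτ, hR⟩ := exists_assignment_of_transitive (X := Fin M)
      (fun x => ⟨N x, hlt x x.2⟩) (fun x y => Warshall (Implies M N bad) M x y)
      (fun x => Fin.ext (hneg x x.2)) (fun x hx => hne x x.2 (congrArg Fin.val hx))
      (fun x y z => trans y y.2 x z) (fun x y => contra x x.2 y y.2) (fun x => h x x.2)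
    refine ⟨fun x => ∃ hx : x < M, τ ⟨x, hx⟩, fun x hx => ?_, ?_⟩
    · simpa [hx, hlt x hx] using hτ ⟨x, hx⟩
    · rintro x hx y hy hxy ⟨⟨_, h₁⟩, ⟨_, h₂⟩⟩
      exact (hτ ⟨y, hy⟩).1
        (hR ⟨x, hx⟩ ⟨N y, hlt y hy⟩ (.of_base ⟨x, hx, y, hy, hxy, .inl ⟨rfl, rfl⟩⟩ _) h₁) h₂

/-! ### Literals of an instance -/

/-- The oriented edges of `T`, numbered `0, …, M - 1`: `A` and `B` are the endpoints, `L` is the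
label, and `N` reverses the orientation. -/
structure IsLiteralTable {n : ℕ} (T : TemporalGraph (Fin n)) (M : ℕ) (A B L N : ℕ → ℕ) :
    Prop where
  neg_lt : ∀ x < M, N x < M
  neg_neg : ∀ x < M, N (N x) = x
  neg_ne : ∀ x < M, N x ≠ x
  tail_neg : ∀ x < M, A (N x) = B x
  head_neg : ∀ x < M, B (N x) = A x
  inj : ∀ x < M, ∀ y < M, A x = A y → B x = B y → x = y
  timeEdge : ∀ x < M, ∃ u v : Fin n, A x = u ∧ B x = v ∧ T.TimeEdge u v (L x)
  exists_lit : ∀ (u v : Fin n) (t : ℕ), T.TimeEdge u v t → ∃ x < M, A x = u ∧ B x = v ∧ L x = t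

/-- The conflict of the oriented edges numbered `x` and `y`. -/
def LitConflict (α : Variant) (M : ℕ) (A B L : ℕ → ℕ) (x y : ℕ) : Prop :=
  B x = A y ∧ A x ≠ B y ∧ α.Before (L x) (L y) ∧
    ¬ ∃ g < M, A g = A x ∧ B g = B y ∧ L y < L g

theorem IsLiteralTable.litConflict_iff {n : ℕ} {T : TemporalGraph (Fin n)} {M : ℕ}
    {A B L N : ℕ → ℕ} (h : IsLiteralTable T M A B L N) (α : Variant) {x y : ℕ} (hx : x < M)
    (hy : y < M) {u v w : Fin n} (hu : A x = u) (hv : B x = v) (hv' : A y = v) (hw : B y = w) :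
    LitConflict α M A B L x y ↔ T.Conflict α u v w := by
  have hex : (∃ g < M, A g = A x ∧ B g = B y ∧ L y < L g) ↔
      ∃ t₃, L y < t₃ ∧ T.TimeEdge u w t₃ := by
    constructor
    · rintro ⟨g, hg, h₁, h₂, h₃⟩
      obtain ⟨a, b, ha, hb, ht⟩ := h.timeEdge g hg
      obtain rfl : a = u := Fin.ext (by omega)
      obtain rfl : b = w := Fin.ext (by omega)
      exact ⟨_, h₃, ht⟩
    · rintro ⟨t, hlt, ht⟩
      obtain ⟨g, hg, h₁, h₂, rfl⟩ := h.exists_lit _ _ _ ht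
      exact ⟨g, hg, by omega, by omega, hlt⟩
  have hxe : T.TimeEdge u v (L x) := by
    obtain ⟨a, b, ha, hb, ht⟩ := h.timeEdge x hx
    obtain rfl : a = u := Fin.ext (by omega)
    obtain rfl : b = v := Fin.ext (by omega)
    exact ht
  have hye : T.TimeEdge v w (L y) := by
    obtain ⟨a, b, ha, hb, ht⟩ := h.timeEdge y hy
    obtain rfl : a = v := Fin.ext (by omega)
    obtain rfl : b = w := Fin.ext (by omega)
    exact ht
  unfold LitConflict TemporalGraph.Conflict
  rw [hex]
  constructor
  · rintro ⟨-, h₁, h₂, h₃⟩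
    exact ⟨fun e => h₁ (by rw [hu, hw, e]), _, _, hxe, hye, h₂, h₃⟩
  · rintro ⟨h₁, t₁, t₂, ht₁, ht₂, h₂, h₃⟩
    obtain rfl := ht₁.unique hxe
    obtain rfl := ht₂.unique hye
    exact ⟨by omega, fun e => h₁ (Fin.ext (by omega)), h₂, h₃⟩

/-- Each oriented edge has exactly one number, so sets of arcs and truth assignments of literals
determine each other, and reversal as negation makes the orientation proper. -/
theorem IsLiteralTable.exists_orientation_iff {n : ℕ} {T : TemporalGraph (Fin n)} {M : ℕ}
    {A B L N : ℕ → ℕ} (h : IsLiteralTable T M A B L N) (α : Variant) :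
    (∃ F, T.IsStrongOrientation α F) ↔
      ∃ τ : ℕ → Prop, (∀ x < M, τ (N x) ↔ ¬ τ x) ∧
        ∀ x < M, ∀ y < M, LitConflict α M A B L x y → ¬ (τ x ∧ τ y) := by
  constructor
  · rintro ⟨F, hF, htr⟩
    rw [hF.stronglyTransitiveOn_iff] at htr
    refine ⟨fun x => ∃ u v : Fin n, A x = u ∧ B x = v ∧ (u, v) ∈ F, fun x hx => ?_, ?_⟩
    · obtain ⟨u, v, hu, hv, ht⟩ := h.timeEdge x hx
      have e₁ : (∃ a b : Fin n, A x = a ∧ B x = b ∧ (a, b) ∈ F) ↔ (u, v) ∈ F := by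
        simp only [hu, hv, Fin.val_inj]
        simp
      have e₂ : (∃ a b : Fin n, A (N x) = a ∧ B (N x) = b ∧ (a, b) ∈ F) ↔ (v, u) ∈ F := by
        simp only [h.tail_neg x hx, h.head_neg x hx, hu, hv, Fin.val_inj]
        simp
      beta_reduce
      rw [e₁, e₂]
      have := hF.2 u v ht.adj
      unfold Xor at this
      tauto
    · rintro x hx y hy hc ⟨⟨u, v, hu, hv, huv⟩, ⟨v', w, hv', hw, hvw⟩⟩
      obtain rfl : v' = v := Fin.ext (by have := hc.1; omega)
      exact htr u trivial v' trivial w trivial ((h.litConflict_iff α hx hy hu hv hv' hw).1 hc)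
        ⟨huv, hvw⟩
  · rintro ⟨τ, hneg, hc⟩
    have hF : T.IsProperOrientation {e | ∃ x < M, A x = e.1 ∧ B x = e.2 ∧ τ x} := by
      constructor
      · rintro u v ⟨x, hx, hu, hv, -⟩
        obtain ⟨a, b, ha, hb, ht⟩ := h.timeEdge x hx
        obtain rfl : a = u := Fin.ext (by simp_all)
        obtain rfl : b = v := Fin.ext (by simp_all)
        exact ht.adj
      · intro u v hadj
        obtain ⟨t, ht⟩ := TemporalGraph.exists_timeEdge hadj
        obtain ⟨x, hx, hu, hv, -⟩ := h.exists_lit u v t ht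
        have hnx := h.neg_lt x hx
        have htn := h.tail_neg x hx
        have hhn := h.head_neg x hx
        have e₁ : (u, v) ∈ {e : Fin n × Fin n | ∃ x < M, A x = e.1 ∧ B x = e.2 ∧ τ x} ↔ τ x := by
          constructor
          · rintro ⟨y, hy, h₁, h₂, h₃⟩
            rwa [h.inj x hx y hy (by simp_all) (by simp_all)]
          · exact fun h' => ⟨x, hx, hu, hv, h'⟩
        have e₂ : (v, u) ∈ {e : Fin n × Fin n | ∃ x < M, A x = e.1 ∧ B x = e.2 ∧ τ x} ↔
            τ (N x) := by
          constructor
          · rintro ⟨y, hy, h₁, h₂, h₃⟩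
            rwa [h.inj (N x) hnx y hy (by simp_all) (by simp_all)]
          · exact fun h' => ⟨N x, hnx, by simp_all, by simp_all, h'⟩
        rw [e₁, e₂, hneg x hx]
        unfold Xor
        tauto
    refine ⟨_, hF, ?_⟩
    rw [hF.stronglyTransitiveOn_iff]
    rintro u - v - w - hconf ⟨⟨x, hx, hu, hv, hτx⟩, ⟨y, hy, hv', hw, hτy⟩⟩
    exact hc x hx y hy ((h.litConflict_iff α hx hy hu hv hv' hw).2 hconf) ⟨hτx, hτy⟩

/-! ### The literal table of an encoded instance -/

/-- Literals `2 e` and `2 e + 1` are the two orientations of the edge number `e`. -/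
def flipLit (x : ℕ) : ℕ := if x % 2 = 0 then x + 1 else x - 1

/-- Entry `0` of the input is the number of vertices, so triple `e` starts at position `3 * e + 1`.
Even literals keep the listed direction. -/
def inputTail (l : List ℕ) (x : ℕ) : ℕ :=
  if x % 2 = 0 then l.getD (3 * (x / 2) + 1) 0 else l.getD (3 * (x / 2) + 2) 0

def inputHead (l : List ℕ) (x : ℕ) : ℕ :=
  if x % 2 = 0 then l.getD (3 * (x / 2) + 2) 0 else l.getD (3 * (x / 2) + 1) 0

def inputLabel (l : List ℕ) (x : ℕ) : ℕ := l.getD (3 * (x / 2) + 3) 0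

theorem getD_flatMap_triple {α : Type*} (f g h : α → ℕ) (L : List α) (e : ℕ) (he : e < L.length) :
    (L.flatMap fun a => [f a, g a, h a]).getD (3 * e) 0 = f L[e] ∧
    (L.flatMap fun a => [f a, g a, h a]).getD (3 * e + 1) 0 = g L[e] ∧
    (L.flatMap fun a => [f a, g a, h a]).getD (3 * e + 2) 0 = h L[e] := by
  induction L generalizing e with
  | nil => simp at he
  | cons a L ih =>
    cases e with
    | zero => simp
    | succ e =>
      have := ih e (by simpa using he)
      simpa [Nat.mul_add, Nat.add_right_comm _ 3] using this

theorem EncodesInstance.isLiteralTable {n : ℕ} {T : TemporalGraph (Fin n)} {l : List ℕ}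
    (h : EncodesInstance ⟨n, T⟩ l) :
    ∃ m, l.length = 3 * m + 1 ∧
      IsLiteralTable T (2 * m) (inputTail l) (inputHead l) (inputLabel l) flipLit := by
  obtain ⟨L, ⟨hnodup, hL⟩, rfl⟩ := h
  dsimp only at L hnodup hL ⊢
  refine ⟨L.length, ?_, ?_⟩
  · simp [List.length_flatMap, mul_comm]
  have hget := getD_flatMap_triple (fun a : Fin n × Fin n × ℕ => (a.1 : ℕ))
    (fun a => (a.2.1 : ℕ)) (fun a => a.2.2) L
  generalize hl : (n :: L.flatMap fun e => [(e.1 : ℕ), (e.2.1 : ℕ), e.2.2]) = l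
  have h₁ : ∀ e (he : e < L.length), l.getD (3 * e + 1) 0 = L[e].1 := by
    intro e he
    rw [← hl, List.getD_cons_succ]
    exact (hget e he).1
  have h₂ : ∀ e (he : e < L.length), l.getD (3 * e + 2) 0 = L[e].2.1 := by
    intro e he
    rw [← hl, List.getD_cons_succ]
    exact (hget e he).2.1
  have h₃ : ∀ e (he : e < L.length), l.getD (3 * e + 3) 0 = L[e].2.2 := by
    intro e he
    rw [← hl, List.getD_cons_succ]
    exact (hget e he).2.2
  have hedge : ∀ e (he : e < L.length), T.TimeEdge L[e].1 L[e].2.1 L[e].2.2 := fun e he =>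
    (hL _ _ _).2 (.inl (List.getElem_mem he))
  have hcase : ∀ x < 2 * L.length, ∃ he : x / 2 < L.length,
      (x % 2 = 0 ∧ inputTail l x = L[x / 2].1 ∧ inputHead l x = L[x / 2].2.1 ∨
        x % 2 = 1 ∧ inputTail l x = L[x / 2].2.1 ∧ inputHead l x = L[x / 2].1) ∧
      inputLabel l x = L[x / 2].2.2 := by
    intro x hx
    have he : x / 2 < L.length := by omega
    refine ⟨he, ?_, h₃ _ he⟩
    rcases Nat.mod_two_eq_zero_or_one x with hx' | hx'
    · left
      simp only [inputTail, inputHead, hx', if_true]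
      exact ⟨trivial, h₁ _ he, h₂ _ he⟩
    · right
      simp only [inputTail, inputHead, hx', one_ne_zero, if_false]
      exact ⟨trivial, h₂ _ he, h₁ _ he⟩
  have hflip : ∀ x, flipLit x / 2 = x / 2 ∧ (flipLit x % 2 = 0 ↔ x % 2 ≠ 0) := by
    intro x
    unfold flipLit
    split <;> omega
  refine ⟨?_, ?_, ?_, ?_, ?_, ?_, ?_, ?_⟩
  · intro x hx
    have := hflip x
    omega
  · intro x hx
    have := hflip x
    have := hflip (flipLit x)
    omega
  · intro x hx
    have := hflip x
    intro e
    rw [e] at this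
    omega
  · intro x hx
    simp only [inputTail, inputHead, (hflip x).1, (hflip x).2]
    by_cases h : x % 2 = 0 <;> simp [h]
  · intro x hx
    simp only [inputTail, inputHead, (hflip x).1, (hflip x).2]
    by_cases h : x % 2 = 0 <;> simp [h]
  · intro x hx y hy hA hB
    obtain ⟨hex, hx', -⟩ := hcase x hx
    obtain ⟨hey, hy', -⟩ := hcase y hy
    -- Equal arcs have equal underlying edges, and no edge is listed twice, so the edge numbers
    -- agree. The parities agree as well since the edge is not a loop.
    have hs : s(L[x / 2].1, L[x / 2].2.1) = s(L[y / 2].1, L[y / 2].2.1) := by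
      rw [Sym2.eq_iff]
      simp only [Fin.ext_iff]
      omega
    have hxy : x / 2 = y / 2 := by
      refine (hnodup.getElem_inj_iff (hi := by simpa using hex) (hj := by simpa using hey)).1 ?_
      simpa using hs
    have hne : (L[x / 2].1 : ℕ) ≠ L[x / 2].2.1 := fun e =>
      (hedge _ hex).adj.ne (Fin.ext e)
    have hL' : L[y / 2] = L[x / 2] := by simp only [hxy]
    rw [hL'] at hy'
    omega
  · intro x hx
    obtain ⟨he, ⟨-, h, h'⟩ | ⟨-, h, h'⟩, h''⟩ := hcase x hx
    · exact ⟨_, _, h, h', h'' ▸ hedge _ he⟩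
    · exact ⟨_, _, h, h', h'' ▸ (hedge _ he).symm⟩
  · intro u v t ht
    rcases (hL u v t).1 ht with hm | hm
    · obtain ⟨e, he, hLe⟩ := List.getElem_of_mem hm
      refine ⟨2 * e, by omega, ?_, ?_, ?_⟩
      · simp [inputTail, h₁ e he, hLe, -List.getD_eq_getElem?_getD]
      · simp [inputHead, h₂ e he, hLe, -List.getD_eq_getElem?_getD]
      · simp [inputLabel, h₃ e he, hLe, -List.getD_eq_getElem?_getD]
    · obtain ⟨e, he, hLe⟩ := List.getElem_of_mem hm
      have hdiv : (2 * e + 1) / 2 = e := by omega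
      refine ⟨2 * e + 1, by omega, ?_, ?_, ?_⟩
      · simp [inputTail, hdiv, h₂ e he, hLe, -List.getD_eq_getElem?_getD]
      · simp [inputHead, hdiv, h₁ e he, hLe, -List.getD_eq_getElem?_getD]
      · simp [inputLabel, hdiv, h₃ e he, hLe, -List.getD_eq_getElem?_getD]

/-! ### Timed verification of programs -/

namespace RAM

@[simp] theorem State.reg_setReg (s : State) (x c y : ℕ) :
    (s.setReg x c).reg y = if y = x then c else s.reg y := by
  simp [State.setReg, Function.update_apply]

@[simp] theorem State.arr_setReg (s : State) (x c : ℕ) : (s.setReg x c).arr = s.arr := rfl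

@[simp] theorem State.reg_setArr (s : State) (a i c : ℕ) : (s.setArr a i c).reg = s.reg := rfl

@[simp] theorem State.arr_setArr (s : State) (a i c b j : ℕ) :
    (s.setArr a i c).arr b j = if b = a ∧ j = i then c else s.arr b j := by
  by_cases h : b = a
  · subst h
    simp [State.setArr, Function.update_apply]
  · simp [State.setArr, h]

/-- Started in `s`, the program halts within `t` steps in a state satisfying `Q`. -/
def Runs (p : Prog) (s : State) (t : ℕ) (Q : State → Prop) : Prop :=
  ∃ k s', Exec p s k s' ∧ k ≤ t ∧ Q s'

namespace Runs

variable {p q : Prog} {s : State} {t t₁ t₂ : ℕ} {P Q : State → Prop}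

theorem mono {t' : ℕ} (h : Runs p s t P) (ht : t ≤ t') (hPQ : ∀ s, P s → Q s) :
    Runs p s t' Q := by
  obtain ⟨k, s', he, hk, hP⟩ := h
  exact ⟨k, s', he, hk.trans ht, hPQ _ hP⟩

theorem seq (hp : Runs p s t₁ P) (hq : ∀ s, P s → Runs q s t₂ Q) :
    Runs (.seq p q) s (t₁ + t₂) Q := by
  obtain ⟨k, s', he, hk, hP⟩ := hp
  obtain ⟨k', s'', he', hk', hQ⟩ := hq s' hP
  exact ⟨_, _, .seq he he', by omega, hQ⟩

theorem skip (h : Q s) : Runs .skip s (t + 1) Q := ⟨_, _, .skip s, by omega, h⟩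

theorem const {x c : ℕ} (h : Q (s.setReg x c)) : Runs (.const x c) s (t + 1) Q :=
  ⟨_, _, .const x c s, by omega, h⟩

theorem add {x y z : ℕ} (h : Q (s.setReg x (s.reg y + s.reg z))) :
    Runs (.add x y z) s (t + 1) Q :=
  ⟨_, _, .add x y z s, by omega, h⟩

theorem load {x a i : ℕ} (h : Q (s.setReg x (s.arr a (s.reg i)))) :
    Runs (.load x a i) s (t + 1) Q :=
  ⟨_, _, .load x a i s, by omega, h⟩

theorem store {a i x : ℕ} (h : Q (s.setArr a (s.reg i) (s.reg x))) :
    Runs (.store a i x) s (t + 1) Q :=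
  ⟨_, _, .store a i x s, by omega, h⟩

/-- This and the next three lemmas peel off one instruction at a time, so a straight-line program is
executed symbolically. -/
theorem const_seq {x c : ℕ} (h : Runs q (s.setReg x c) t Q) :
    Runs (.seq (.const x c) q) s (t + 1) Q := by
  rw [add_comm]
  exact seq (t₁ := 1) (const (t := 0) h) fun _ => id

theorem add_seq {x y z : ℕ} (h : Runs q (s.setReg x (s.reg y + s.reg z)) t Q) :
    Runs (.seq (.add x y z) q) s (t + 1) Q := by
  rw [add_comm]
  exact seq (t₁ := 1) (P := fun s' => Runs q s' t Q) (add (t := 0) h) fun _ => id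

theorem load_seq {x a i : ℕ} (h : Runs q (s.setReg x (s.arr a (s.reg i))) t Q) :
    Runs (.seq (.load x a i) q) s (t + 1) Q := by
  rw [add_comm]
  exact seq (t₁ := 1) (P := fun s' => Runs q s' t Q) (load (t := 0) h) fun _ => id

theorem store_seq {a i x : ℕ} (h : Runs q (s.setArr a (s.reg i) (s.reg x)) t Q) :
    Runs (.seq (.store a i x) q) s (t + 1) Q := by
  rw [add_comm]
  exact seq (t₁ := 1) (P := fun s' => Runs q s' t Q) (store (t := 0) h) fun _ => id

/-- Both branches share one budget; a shorter branch is padded through the free `t` of `Runs.skip`.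
-/
theorem ite {b : Test} (hp : b.Holds s → Runs p s t Q) (hq : ¬ b.Holds s → Runs q s t Q) :
    Runs (.ite b p q) s (t + 1) Q := by
  by_cases hb : b.Holds s
  · obtain ⟨k, s', he, hk, hQ⟩ := hp hb
    exact ⟨_, _, .ite_true hb he, by omega, hQ⟩
  · obtain ⟨k, s', he, hk, hQ⟩ := hq hb
    exact ⟨_, _, .ite_false hb he, by omega, hQ⟩

theorem loop {b : Test} (m : ℕ) (Inv : ℕ → State → Prop)
    (hstep : ∀ e < m, ∀ s, Inv e s → b.Holds s ∧ Runs p s t (Inv (e + 1)))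
    (hend : ∀ s, Inv m s → ¬ b.Holds s) (h₀ : Inv 0 s) :
    Runs (.loop b p) s (m * (t + 1) + 1) (Inv m) := by
  -- Induction on the number `d` of remaining rounds, while the index `e` of the invariant
  -- increases.
  suffices h : ∀ d e s, e + d = m → Inv e s → Runs (.loop b p) s (d * (t + 1) + 1) (Inv m) from
    h m 0 s (zero_add m) h₀
  intro d
  induction d with
  | zero =>
    rintro e s rfl he
    exact ⟨_, _, .loop_done (hend _ he), by omega, he⟩
  | succ d ih =>
    intro e s hed he
    obtain ⟨hb, k, s', hex, hk, he'⟩ := hstep e (by omega) s he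
    obtain ⟨k', s'', hex', hk', hfin⟩ := ih (e + 1) s' (by omega) he'
    refine ⟨_, _, .loop_step hb hex hex', ?_, hfin⟩
    rw [Nat.succ_mul]
    omega

end Runs

/-- The loop `for i < M do p`; registers `1` and `3` hold `1` and `M`. -/
def forProg (i : ℕ) (p : Prog) : Prog :=
  .seq (.const i 0) (.loop (.lt i 3) (.seq p (.add i i 1)))

/-- The running time of a loop over `{0, …, M - 1}` with body time `t`. -/
def forTime (M t : ℕ) : ℕ := M * (t + 2) + 2

/-- A round costs the body, the increment and the test, hence `t + 2`; initialization and the last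
failing test add `2`. By `hset` the invariant ignores the counter, so changing the counter cannot
break it. -/
theorem Runs.forProg {i : ℕ} {p : Prog} {s : State} {t M : ℕ} {Q : State → Prop}
    (Inv : ℕ → State → Prop)
    (hctx : ∀ j s, Inv j s → s.reg 1 = 1 ∧ s.reg 3 = M)
    (hset : ∀ j s c, Inv j s → Inv j (s.setReg i c))
    (hbody : ∀ j < M, ∀ s, Inv j s → s.reg i = j →
      Runs p s t (fun s' => s'.reg i = j ∧ Inv (j + 1) s'))
    (h₀ : Inv 0 s) (hQ : ∀ s, Inv M s → Q s) :
    Runs (forProg i p) s (forTime M t) Q := by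
  refine Runs.const_seq (t := M * (t + 2) + 1) ?_
  refine (Runs.loop (t := t + 1) M (fun j s => s.reg i = j ∧ Inv j s) ?_ ?_ ?_).mono le_rfl
    fun s h => hQ s h.2
  · rintro j hj s ⟨hij, hI⟩
    refine ⟨?_, ?_⟩
    · simpa [Test.Holds, hij, (hctx _ _ hI).2] using hj
    · refine Runs.seq (hbody j hj s hI hij) ?_
      rintro s ⟨hij, hI⟩
      refine Runs.add (t := 0) ⟨?_, hset _ _ _ hI⟩
      simp [hij, (hctx _ _ hI).1]
  · rintro s ⟨hij, hI⟩
    simp [Test.Holds, hij, (hctx _ _ hI).2]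
  · exact ⟨by simp, hset _ _ _ h₀⟩

end RAM

namespace RAM

/-! ### The decision procedure -/

/-- `α.Before a b` means `a < b + α.offset`. -/
def _root_.Variant.offset : Variant → ℕ
  | .strong => 1
  | .strongStrict => 0

theorem _root_.Variant.before_iff (α : Variant) (a b : ℕ) : α.Before a b ↔ a < b + α.offset := by
  cases α
  · exact Nat.lt_succ_iff.symm
  · exact Iff.rfl

/-- Reads one edge: enters its two orientations into the arrays `1` (tails), `2` (heads),
`3` (labels) and `4` (reversals). -/
def readBody : Prog :=
  .seq (.load 10 0 8) <| .seq (.add 8 8 1) <| .seq (.load 11 0 8) <| .seq (.add 8 8 1) <|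
  .seq (.load 12 0 8) <| .seq (.add 8 8 1) <| .seq (.add 9 3 1) <|
  .seq (.store 1 3 10) <| .seq (.store 2 3 11) <| .seq (.store 3 3 12) <| .seq (.store 4 3 9) <|
  .seq (.store 1 9 11) <| .seq (.store 2 9 10) <| .seq (.store 3 9 12) <| .seq (.store 4 9 3) <|
  .add 3 9 1

/-- Array `5` receives the row offsets `x * M`. -/
def rowBody : Prog := .seq (.store 5 5 8) (.add 8 8 3)

/-- Looks for the edge that would resolve the conflict. -/
def searchBody : Prog :=
  .seq (.load 16 1 7) <| .seq (.load 17 2 7) <| .seq (.load 18 3 7) <|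
  .ite (.eq 16 10) (.ite (.eq 17 13) (.ite (.lt 14 18) (.const 15 1) .skip) .skip) .skip

/-- Stores the two implications of a conflict in the matrix in array `6`. -/
def recordProg : Prog :=
  .seq (.load 16 4 5) <| .seq (.load 17 4 6) <| .seq (.load 18 5 5) <| .seq (.load 19 5 6) <|
  .seq (.add 18 18 17) <| .seq (.add 19 19 16) <| .seq (.store 6 18 1) (.store 6 19 1)

/-- The nested tests follow the clauses of `LitConflict`. Register `8` holds the second label plus
the offset, which serves both variants; register `15` flags a resolving edge. -/
def clauseBody : Prog :=
  .seq (.load 10 1 5) <| .seq (.load 11 2 5) <| .seq (.load 12 3 5) <|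
  .seq (.load 9 1 6) <| .seq (.load 13 2 6) <| .seq (.load 14 3 6) <| .seq (.add 8 14 4) <|
  .ite (.eq 11 9)
    (.ite (.eq 10 13) .skip
      (.ite (.lt 12 8)
        (.seq (.const 15 0) <| .seq (forProg 7 searchBody) (.ite (.eq 15 2) recordProg .skip))
        .skip))
    .skip

def warshallBody : Prog :=
  .seq (.load 8 5 5) <| .seq (.load 9 5 7) <| .seq (.add 10 8 7) <| .seq (.load 10 6 10) <|
  .ite (.eq 10 2) .skip <|
  .seq (.add 11 9 6) <| .seq (.load 11 6 11) <|
  .ite (.eq 11 2) .skip <|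
  .seq (.add 12 8 6) (.store 6 12 1)

/-- Compares a literal with its negation. -/
def checkBody : Prog :=
  .seq (.load 8 4 5) <| .seq (.load 9 5 8) <| .seq (.load 10 5 5) <|
  .seq (.add 10 10 8) <| .seq (.add 9 9 5) <| .seq (.load 10 6 10) <| .seq (.load 9 6 9) <|
  .ite (.eq 10 2) .skip <| .ite (.eq 9 2) .skip (.const 0 0)

/-- Register `2` is never written and serves as the constant zero. Reading starts at position `1`:
the number of vertices plays no role, since isolated vertices carry no constraint. -/
def decideProg (α : Variant) : Prog :=
  .seq (.const 1 1) <| .seq (.const 4 α.offset) <| .seq (.const 8 1) <|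
  .seq (.loop (.lt 8 0) readBody) <|
  .seq (.const 8 0) <| .seq (forProg 5 rowBody) <|
  .seq (forProg 5 (forProg 6 clauseBody)) <|
  .seq (forProg 7 (forProg 5 (forProg 6 warshallBody))) <|
  .seq (.const 0 1) (forProg 5 checkBody)

/-! ### Memory predicates -/

/-- The literal table and the constants are in place. -/
structure HasTable (α : Variant) (M : ℕ) (A B L N : ℕ → ℕ) (s : State) : Prop where
  one : s.reg 1 = 1
  zero : s.reg 2 = 0
  size : s.reg 3 = M
  offset : s.reg 4 = α.offset
  tail : ∀ x < M, s.arr 1 x = A x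
  head : ∀ x < M, s.arr 2 x = B x
  label : ∀ x < M, s.arr 3 x = L x
  neg : ∀ x < M, s.arr 4 x = N x

/-- Array `5` holds the row offsets. -/
def HasRows (M : ℕ) (s : State) : Prop := ∀ x < M, s.arr 5 x = x * M

/-- Array `6` holds the relation `P` on `{0, …, M - 1}` as a matrix. -/
def HasMatrix (M : ℕ) (P : ℕ → ℕ → Prop) (s : State) : Prop :=
  ∀ i < M, ∀ j < M, (s.arr 6 (i * M + j) ≠ 0 ↔ P i j)

section Memory

variable {α : Variant} {M : ℕ} {A B L N : ℕ → ℕ} {P P' : ℕ → ℕ → Prop} {s : State} {x a i c : ℕ}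

theorem HasTable.setReg (h : HasTable α M A B L N s) (hx : x = 0 ∨ 5 ≤ x) :
    HasTable α M A B L N (s.setReg x c) where
  one := by rw [State.reg_setReg, if_neg (by omega), h.one]
  zero := by rw [State.reg_setReg, if_neg (by omega), h.zero]
  size := by rw [State.reg_setReg, if_neg (by omega), h.size]
  offset := by rw [State.reg_setReg, if_neg (by omega), h.offset]
  tail := h.tail
  head := h.head
  label := h.label
  neg := h.neg

theorem HasTable.setArr (h : HasTable α M A B L N s) (ha : 5 ≤ a) :
    HasTable α M A B L N (s.setArr a i c) where
  one := h.one
  zero := h.zero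
  size := h.size
  offset := h.offset
  tail x hx := by rw [State.arr_setArr, if_neg (by omega), h.tail x hx]
  head x hx := by rw [State.arr_setArr, if_neg (by omega), h.head x hx]
  label x hx := by rw [State.arr_setArr, if_neg (by omega), h.label x hx]
  neg x hx := by rw [State.arr_setArr, if_neg (by omega), h.neg x hx]

theorem HasRows.setArr (h : HasRows M s) (ha : 6 ≤ a) : HasRows M (s.setArr a i c) := fun x hx => by
  rw [State.arr_setArr, if_neg (by omega), h x hx]

@[simp] theorem hasRows_setReg : HasRows M (s.setReg x c) ↔ HasRows M s := Iff.rfl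

@[simp] theorem hasMatrix_setReg : HasMatrix M P (s.setReg x c) ↔ HasMatrix M P s := Iff.rfl

theorem HasMatrix.congr (h : HasMatrix M P s) (hP : ∀ i < M, ∀ j < M, P i j ↔ P' i j) :
    HasMatrix M P' s := fun i hi j hj => (h i hi j hj).trans (hP i hi j hj)

/-- Uniqueness of the last digit in base `M`: distinct matrix entries never share an address. -/
theorem address_inj {x y i j : ℕ} (hy : y < M) (hj : j < M) (h : i * M + j = x * M + y) :
    i = x ∧ j = y := by
  have hj' : j = y := by
    have := congrArg (· % M) h
    simpa [Nat.mul_add_mod', Nat.mod_eq_of_lt, hy, hj] using this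
  subst hj'
  exact ⟨Nat.eq_of_mul_eq_mul_right (by omega) (Nat.add_right_cancel h), rfl⟩

theorem HasMatrix.setArr {y : ℕ} (h : HasMatrix M P s) (hy : y < M) (hc : c ≠ 0) :
    HasMatrix M (fun i j => P i j ∨ (i = x ∧ j = y)) (s.setArr 6 (x * M + y) c) := by
  intro i hi j hj
  rw [State.arr_setArr]
  by_cases he : i * M + j = x * M + y
  · simp [hc, address_inj hy hj he]
  · have : ¬ (i = x ∧ j = y) := by
      rintro ⟨rfl, rfl⟩
      exact he rfl
    rw [if_neg (fun h' => he h'.2), h i hi j hj]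
    tauto

end Memory

/-! ### Correctness of the parts -/

section Parts

variable {α : Variant} {M : ℕ} {A B L N : ℕ → ℕ}

/-- The machine cannot multiply, so register `8` accumulates the multiples of `M`. -/
theorem runs_rows {s : State} (h : HasTable α M A B L N s) (h₈ : s.reg 8 = 0)
    (h₆ : ∀ i, s.arr 6 i = 0) :
    Runs (forProg 5 rowBody) s (forTime M 2) (fun s' =>
      HasTable α M A B L N s' ∧ HasRows M s' ∧ ∀ i, s'.arr 6 i = 0) := by
  refine Runs.forProg (M := M) (fun j s => HasTable α M A B L N s ∧ s.reg 8 = j * M ∧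
    (∀ x < j, s.arr 5 x = x * M) ∧ ∀ i, s.arr 6 i = 0) ?_ ?_ ?_ ?_ ?_
  · rintro j s ⟨h, -⟩
    exact ⟨h.one, h.size⟩
  · rintro j s c ⟨h, h₈, h₅, h₆⟩
    exact ⟨h.setReg (by omega), by simpa using h₈, h₅, h₆⟩
  · rintro j hj s ⟨h, h₈, h₅, h₆⟩ hij
    refine Runs.store_seq (Runs.add ⟨by simpa using hij, ?_, ?_, ?_, ?_⟩)
    · exact (h.setArr (by omega)).setReg (by omega)
    · simp [h₈, h.size, Nat.succ_mul]
    · intro x hx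
      by_cases hxj : x = j
      · simp [hxj, hij, h₈]
      · simp [hxj, hij, h₅ x (by omega)]
    · simp [h₆]
  · exact ⟨h, by simpa using h₈, by simp, h₆⟩
  · rintro s ⟨h, -, h₅, h₆⟩
    exact ⟨h, h₅, h₆⟩

/-- `P` is a frame: any property insensitive to registers from `7` on survives the search. -/
theorem runs_search {s : State} {P : State → Prop} {x y : ℕ} (h : HasTable α M A B L N s)
    (hP : ∀ s r c, 7 ≤ r → P s → P (s.setReg r c)) (hs : P s)
    (h₁₀ : s.reg 10 = A x) (h₁₃ : s.reg 13 = B y) (h₁₄ : s.reg 14 = L y) (h₁₅ : s.reg 15 = 0) :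
    Runs (forProg 7 searchBody) s (forTime M 7) (fun s' =>
      HasTable α M A B L N s' ∧ P s' ∧
        (s'.reg 15 = 0 ↔ ¬ ∃ g < M, A g = A x ∧ B g = B y ∧ L y < L g)) := by
  refine Runs.forProg (M := M) (fun j s => (HasTable α M A B L N s ∧ P s) ∧
    (s.reg 10 = A x ∧ s.reg 13 = B y ∧ s.reg 14 = L y) ∧
    (s.reg 15 = 0 ↔ ¬ ∃ g < j, A g = A x ∧ B g = B y ∧ L y < L g)) ?_ ?_ ?_ ?_ ?_
  · rintro j s ⟨⟨h, -⟩, -⟩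
    exact ⟨h.one, h.size⟩
  · rintro j s c ⟨⟨h, hs⟩, h', h₁₅⟩
    exact ⟨⟨h.setReg (by omega), hP _ _ _ (by omega) hs⟩, by simpa using h', by simpa using h₁₅⟩
  · rintro j hj s ⟨⟨h, hs⟩, ⟨h₁₀, h₁₃, h₁₄⟩, h₁₅⟩ hij
    have hsucc : (∃ g < j + 1, A g = A x ∧ B g = B y ∧ L y < L g) ↔
        (∃ g < j, A g = A x ∧ B g = B y ∧ L y < L g) ∨
          (A j = A x ∧ B j = B y ∧ L y < L j) := by
      simp only [Nat.lt_succ_iff_lt_or_eq, or_and_right, exists_or, exists_eq_left]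
    refine Runs.load_seq (Runs.load_seq (Runs.load_seq (t := 4) ?_))
    simp only [State.reg_setReg, State.arr_setReg]
    simp only [Nat.reduceEqDiff, if_false, hij, h.tail j hj, h.head j hj, h.label j hj]
    generalize hs' : State.setReg _ 18 _ = s'
    have ht' : HasTable α M A B L N s' := by
      rw [← hs']
      iterate 3 refine HasTable.setReg ?_ (by omega)
      exact h
    have hp' : P s' := by
      rw [← hs']
      iterate 3 refine hP _ _ _ (by omega) ?_
      exact hs
    have r₇ : s'.reg 7 = j := by simp [← hs', hij]
    have r₁₀ : s'.reg 10 = A x := by simp [← hs', h₁₀]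
    have r₁₃ : s'.reg 13 = B y := by simp [← hs', h₁₃]
    have r₁₄ : s'.reg 14 = L y := by simp [← hs', h₁₄]
    have r₁₅ : s'.reg 15 = s.reg 15 := by simp [← hs']
    have r₁₆ : s'.reg 16 = A j := by simp [← hs']
    have r₁₇ : s'.reg 17 = B j := by simp [← hs']
    have r₁₈ : s'.reg 18 = L j := by simp [← hs']
    clear hs'
    have hskip : ¬ (A j = A x ∧ B j = B y ∧ L y < L j) → s'.reg 7 = j ∧
        (HasTable α M A B L N s' ∧ P s') ∧
        (s'.reg 10 = A x ∧ s'.reg 13 = B y ∧ s'.reg 14 = L y) ∧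
        (s'.reg 15 = 0 ↔ ¬ ∃ g < j + 1, A g = A x ∧ B g = B y ∧ L y < L g) := by
      intro hn
      rw [hsucc, or_iff_left hn, r₁₅]
      exact ⟨r₇, ⟨ht', hp'⟩, ⟨r₁₀, r₁₃, r₁₄⟩, h₁₅⟩
    refine Runs.ite (fun hb₁ => Runs.ite (fun hb₂ => Runs.ite (fun hb₃ => Runs.const (t := 0) ?_)
      fun hb => Runs.skip (t := 0) (hskip fun hc => hb ?_))
      fun hb => Runs.skip (t := 1) (hskip fun hc => hb ?_))
      fun hb => Runs.skip (t := 2) (hskip fun hc => hb ?_)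
    · refine ⟨by simpa using r₇, ⟨ht'.setReg (by omega), hP _ _ _ (by omega) hp'⟩,
        by simp [r₁₀, r₁₃, r₁₄], ?_⟩
      simp only [Test.Holds, r₁₀, r₁₃, r₁₄, r₁₆, r₁₇, r₁₈] at hb₁ hb₂ hb₃
      rw [hsucc]
      simp [hb₁, hb₂, hb₃]
    · simpa [Test.Holds, r₁₄, r₁₈] using hc.2.2
    · simpa [Test.Holds, r₁₃, r₁₇] using hc.2.1
    · simpa [Test.Holds, r₁₀, r₁₆] using hc.1
  · exact ⟨⟨h, hs⟩, ⟨h₁₀, h₁₃, h₁₄⟩, by simpa using h₁₅⟩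
  · rintro s ⟨⟨h, hs⟩, -, h₁₅⟩
    exact ⟨h, hs, h₁₅⟩

/-- The implications of the constraints `bad a b` with `(a, b)` lexicographically before
`(x, y)`. -/
def ImpliesBefore (M : ℕ) (N : ℕ → ℕ) (bad : ℕ → ℕ → Prop) (x y i j : ℕ) : Prop :=
  ∃ a < M, ∃ b < M, (a < x ∨ (a = x ∧ b < y)) ∧ bad a b ∧
    ((i = a ∧ j = N b) ∨ (i = b ∧ j = N a))

theorem impliesBefore_succ {bad : ℕ → ℕ → Prop} {x y i j : ℕ} (hx : x < M) (hy : y < M) :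
    ImpliesBefore M N bad x (y + 1) i j ↔ ImpliesBefore M N bad x y i j ∨
      (bad x y ∧ ((i = x ∧ j = N y) ∨ (i = y ∧ j = N x))) := by
  constructor
  · rintro ⟨a, ha, b, hb, hlt, h⟩
    by_cases he : a = x ∧ b = y
    · obtain ⟨rfl, rfl⟩ := he
      exact .inr h
    · exact .inl ⟨a, ha, b, hb, by omega, h⟩
  · rintro (⟨a, ha, b, hb, hlt, h⟩ | h)
    · exact ⟨a, ha, b, hb, by omega, h⟩
    · exact ⟨x, hx, y, hy, by omega, h⟩

theorem impliesBefore_row {bad : ℕ → ℕ → Prop} {x i j : ℕ} :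
    ImpliesBefore M N bad x M i j ↔ ImpliesBefore M N bad (x + 1) 0 i j := by
  constructor
  · rintro ⟨a, ha, b, hb, hlt, h⟩
    exact ⟨a, ha, b, hb, by omega, h⟩
  · rintro ⟨a, ha, b, hb, hlt, h⟩
    exact ⟨a, ha, b, hb, by omega, h⟩

theorem impliesBefore_all {bad : ℕ → ℕ → Prop} {i j : ℕ} :
    ImpliesBefore M N bad M 0 i j ↔ Implies M N bad i j := by
  constructor
  · rintro ⟨a, ha, b, hb, -, h⟩
    exact ⟨a, ha, b, hb, h⟩
  · rintro ⟨a, ha, b, hb, h⟩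
    exact ⟨a, ha, b, hb, .inl ha, h⟩

theorem runs_record {s : State} {x y : ℕ} {P : ℕ → ℕ → Prop} (hx : x < M) (hy : y < M)
    (hN : ∀ x < M, N x < M)
    (h : HasTable α M A B L N s) (hr : HasRows M s) (hm : HasMatrix M P s) (h₅ : s.reg 5 = x)
    (h₆ : s.reg 6 = y) :
    Runs recordProg s 8 (fun s' => s'.reg 6 = y ∧ HasTable α M A B L N s' ∧ HasRows M s' ∧
      s'.reg 5 = x ∧
      HasMatrix M (fun i j => P i j ∨ ((i = x ∧ j = N y) ∨ (i = y ∧ j = N x))) s') := by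
  refine Runs.load_seq (Runs.load_seq (Runs.load_seq (Runs.load_seq (Runs.add_seq (Runs.add_seq
    (Runs.store_seq (Runs.store (t := 0) ?_)))))))
  refine ⟨by simpa using h₆, ?_, ?_, by simpa using h₅, ?_⟩
  · refine HasTable.setArr (HasTable.setArr ?_ (by omega)) (by omega)
    iterate 6 refine HasTable.setReg ?_ (by omega)
    exact h
  · exact HasRows.setArr (HasRows.setArr (by simpa using hr) (by omega)) (by omega)
  · have h₁ := (hm.setArr (x := x) (c := 1) (hN y hy) one_ne_zero).setArr (x := y) (c := 1)
      (hN x hx) one_ne_zero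
    simp only [State.reg_setReg, State.arr_setReg, State.reg_setArr]
    simp only [Nat.reduceEqDiff, if_false, if_true, h₅, h₆, hr x hx, hr y hy, h.neg x hx,
      h.neg y hy, h.one]
    exact HasMatrix.congr h₁ fun i _ j _ => or_assoc

/-- Seven loads and additions, three tests, the reset of the flag, the search, and `9` for the flag
test with the eight instructions of `recordProg`. -/
def clauseTime (M : ℕ) : ℕ := 7 + (3 + (1 + (forTime M 7 + 9)))

theorem runs_clauseBody {s : State} {x y : ℕ} (hx : x < M) (hy : y < M) (hN : ∀ x < M, N x < M)
    (h : HasTable α M A B L N s) (hr : HasRows M s) (h₅ : s.reg 5 = x) (h₆ : s.reg 6 = y)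
    (hm : HasMatrix M (ImpliesBefore M N (LitConflict α M A B L) x y) s) :
    Runs clauseBody s (clauseTime M) (fun s' => s'.reg 6 = y ∧ HasTable α M A B L N s' ∧
      HasRows M s' ∧ s'.reg 5 = x ∧
      HasMatrix M (ImpliesBefore M N (LitConflict α M A B L) x (y + 1)) s') := by
  refine (?_ : Runs clauseBody s ((1 + (forTime M 7 + 9) + 3) + 7) _).mono
    (by unfold clauseTime; omega) fun _ => id
  refine Runs.load_seq (Runs.load_seq (Runs.load_seq (Runs.load_seq (Runs.load_seq (Runs.load_seq
    (Runs.add_seq ?_))))))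
  simp only [State.reg_setReg, State.arr_setReg]
  simp only [Nat.reduceEqDiff, if_false, if_true, h₅, h₆, h.tail x hx, h.tail y hy,
    h.head x hx, h.head y hy, h.label x hx, h.label y hy, h.offset]
  generalize hs' : State.setReg _ 8 _ = s'
  have ht' : HasTable α M A B L N s' := by
    rw [← hs']
    iterate 7 refine HasTable.setReg ?_ (by omega)
    exact h
  have hr' : HasRows M s' := by rw [← hs']; exact hr
  have hm' : HasMatrix M (ImpliesBefore M N (LitConflict α M A B L) x y) s' := by
    rw [← hs']; exact hm
  have r₅ : s'.reg 5 = x := by simp [← hs', h₅]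
  have r₆ : s'.reg 6 = y := by simp [← hs', h₆]
  have r₈ : s'.reg 8 = L y + α.offset := by simp [← hs']
  have r₉ : s'.reg 9 = A y := by simp [← hs']
  have r₁₀ : s'.reg 10 = A x := by simp [← hs']
  have r₁₁ : s'.reg 11 = B x := by simp [← hs']
  have r₁₂ : s'.reg 12 = L x := by simp [← hs']
  have r₁₃ : s'.reg 13 = B y := by simp [← hs']
  have r₁₄ : s'.reg 14 = L y := by simp [← hs']
  clear hs'
  have hskip : ∀ s'', HasTable α M A B L N s'' → HasRows M s'' → s''.reg 5 = x → s''.reg 6 = y →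
      HasMatrix M (ImpliesBefore M N (LitConflict α M A B L) x y) s'' →
      ¬ LitConflict α M A B L x y → s''.reg 6 = y ∧ HasTable α M A B L N s'' ∧
      HasRows M s'' ∧ s''.reg 5 = x ∧
      HasMatrix M (ImpliesBefore M N (LitConflict α M A B L) x (y + 1)) s'' := by
    intro s'' h₁ h₂ h₃ h₄ h₅ hc
    refine ⟨h₄, h₁, h₂, h₃, h₅.congr fun i _ j _ => ?_⟩
    rw [impliesBefore_succ hx hy]
    tauto
  refine Runs.ite (fun hb₁ => Runs.ite (fun hb => Runs.skip ?_) fun hb₂ =>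
    Runs.ite (fun hb₃ => ?_) fun hb => Runs.skip (t := _ + 8) ?_) fun hb => Runs.skip ?_
  · refine hskip _ ht' hr' r₅ r₆ hm' fun hc => hc.2.1 ?_
    simpa [Test.Holds, r₁₀, r₁₃] using hb
  · rw [add_comm 1]
    refine Runs.const_seq (Runs.seq (runs_search (x := x) (y := y)
      (P := fun s => HasRows M s ∧ s.reg 5 = x ∧ s.reg 6 = y ∧
        HasMatrix M (ImpliesBefore M N (LitConflict α M A B L) x y) s)
      (ht'.setReg (by omega)) ?_ ?_ ?_ ?_ ?_ ?_) ?_)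
    · rintro s r c h ⟨h₁, h₂, h₃, h₄⟩
      refine ⟨h₁, ?_, ?_, h₄⟩
      · rwa [State.reg_setReg, if_neg (by omega)]
      · rwa [State.reg_setReg, if_neg (by omega)]
    · exact ⟨hr', by simpa using r₅, by simpa using r₆, hm'⟩
    · simpa using r₁₀
    · simpa using r₁₃
    · simpa using r₁₄
    · simp
    · rintro s'' ⟨ht'', ⟨hr'', r₅', r₆', hm''⟩, hex⟩
      refine Runs.ite (fun hb => ?_) fun hb => Runs.skip (t := 7) ?_
      · have hc : LitConflict α M A B L x y := by
          refine ⟨?_, ?_, (α.before_iff _ _).2 ?_, hex.1 ?_⟩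
          · simpa [Test.Holds, r₁₁, r₉] using hb₁
          · simpa [Test.Holds, r₁₀, r₁₃] using hb₂
          · simpa [Test.Holds, r₁₂, r₈] using hb₃
          · simpa [Test.Holds, ht''.zero] using hb
        refine (runs_record hx hy hN ht'' hr'' hm'' r₅' r₆').mono le_rfl ?_
        rintro s ⟨h₁, h₂, h₃, h₄, h₅⟩
        refine ⟨h₁, h₂, h₃, h₄, h₅.congr fun i _ j _ => ?_⟩
        rw [impliesBefore_succ hx hy]
        tauto
      · refine hskip _ ht'' hr'' r₅' r₆' hm'' fun hc => hb ?_
        simpa [Test.Holds, ht''.zero] using hex.2 hc.2.2.2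
  · refine hskip _ ht' hr' r₅ r₆ hm' fun hc => hb ?_
    simpa [Test.Holds, r₁₂, r₈] using (α.before_iff _ _).1 hc.2.2.1
  · refine hskip _ ht' hr' r₅ r₆ hm' fun hc => hb ?_
    simpa [Test.Holds, r₁₁, r₉] using hc.1

theorem runs_clauses {s : State} (hN : ∀ x < M, N x < M) (h : HasTable α M A B L N s)
    (hr : HasRows M s) (h₆ : ∀ i, s.arr 6 i = 0) :
    Runs (forProg 5 (forProg 6 clauseBody)) s (forTime M (forTime M (clauseTime M))) (fun s' =>
      HasTable α M A B L N s' ∧ HasRows M s' ∧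
        HasMatrix M (Implies M N (LitConflict α M A B L)) s') := by
  refine Runs.forProg (M := M) (fun x s => HasTable α M A B L N s ∧ HasRows M s ∧
    HasMatrix M (ImpliesBefore M N (LitConflict α M A B L) x 0) s) ?_ ?_ ?_ ?_ ?_
  · rintro x s ⟨h, -⟩
    exact ⟨h.one, h.size⟩
  · rintro x s c ⟨h, hr, hm⟩
    exact ⟨h.setReg (by omega), hr, hm⟩
  · rintro x hx s ⟨h, hr, hm⟩ h₅
    refine Runs.forProg (M := M) (fun y s => HasTable α M A B L N s ∧ HasRows M s ∧
      s.reg 5 = x ∧ HasMatrix M (ImpliesBefore M N (LitConflict α M A B L) x y) s) ?_ ?_ ?_ ?_ ?_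
    · rintro y s ⟨h, -⟩
      exact ⟨h.one, h.size⟩
    · rintro y s c ⟨h, hr, h₅, hm⟩
      exact ⟨h.setReg (by omega), hr, by simpa using h₅, hm⟩
    · rintro y hy s ⟨h, hr, h₅, hm⟩ h₆
      exact runs_clauseBody hx hy hN h hr h₅ h₆ hm
    · exact ⟨h, hr, h₅, hm⟩
    · rintro s ⟨h, hr, h₅, hm⟩
      exact ⟨h₅, h, hr, hm.congr fun i _ j _ => impliesBefore_row⟩
  · refine ⟨h, hr, fun i _ j _ => ?_⟩
    simp [h₆, ImpliesBefore]
  · rintro s ⟨h, hr, hm⟩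
    exact ⟨h, hr, hm.congr fun i _ j _ => impliesBefore_all⟩

/-- The matrix of Warshall's algorithm in round `k` when the entries lexicographically before
`(x, y)` have been treated. -/
def WarshallBefore (R : ℕ → ℕ → Prop) (k x y i j : ℕ) : Prop :=
  Warshall R k i j ∨ ((i < x ∨ (i = x ∧ j < y)) ∧ Warshall R (k + 1) i j)

/-- Round `k` leaves column `k` unchanged, and likewise row `k`. This is why one matrix can be
updated in place: the entries read are the same before and after their own treatment. -/
theorem warshallBefore_col {R : ℕ → ℕ → Prop} {k x y i : ℕ} :
    WarshallBefore R k x y i k ↔ Warshall R k i k := by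
  simp only [WarshallBefore, Warshall]
  tauto

theorem warshallBefore_row {R : ℕ → ℕ → Prop} {k x y j : ℕ} :
    WarshallBefore R k x y k j ↔ Warshall R k k j := by
  simp only [WarshallBefore, Warshall]
  tauto

theorem warshallBefore_succ {R : ℕ → ℕ → Prop} {k x y i j : ℕ} :
    WarshallBefore R k x (y + 1) i j ↔ WarshallBefore R k x y i j ∨
      ((i = x ∧ j = y) ∧ Warshall R k x k ∧ Warshall R k k y) := by
  by_cases he : i = x ∧ j = y
  · obtain ⟨rfl, rfl⟩ := he
    simp [WarshallBefore, Warshall]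
  · have : (i < x ∨ (i = x ∧ j < y + 1)) ↔ (i < x ∨ (i = x ∧ j < y)) := by omega
    simp only [WarshallBefore, this]
    tauto

theorem runs_warshallBody {s : State} {R : ℕ → ℕ → Prop} {k x y : ℕ} (hk : k < M) (hx : x < M)
    (hy : y < M) (h : HasTable α M A B L N s) (hr : HasRows M s) (h₇ : s.reg 7 = k)
    (h₅ : s.reg 5 = x) (h₆ : s.reg 6 = y) (hm : HasMatrix M (WarshallBefore R k x y) s) :
    Runs warshallBody s 10 (fun s' => s'.reg 6 = y ∧ HasTable α M A B L N s' ∧ HasRows M s' ∧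
      s'.reg 7 = k ∧ s'.reg 5 = x ∧ HasMatrix M (WarshallBefore R k x (y + 1)) s') := by
  refine Runs.load_seq (Runs.load_seq (Runs.add_seq (Runs.load_seq (t := 6) ?_)))
  refine Runs.ite (t := 5) (fun hb => Runs.skip (t := 4) ?_) fun hb₁ =>
    Runs.add_seq (Runs.load_seq (t := 3)
      (Runs.ite (t := 2) (fun hb => Runs.skip (t := 1) ?_) fun hb₂ =>
        Runs.add_seq (t := 1) (Runs.store (t := 0) ?_)))
  · refine ⟨by simpa using h₆, ?_, by simpa using hr, by simpa using h₇, by simpa using h₅, ?_⟩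
    · iterate 4 refine HasTable.setReg ?_ (by omega)
      exact h
    · simp [Test.Holds, h₅, h₇, hr x hx, h.zero] at hb
      -- A zero at `(x, k)` means that no path through `k` starts at `x`, so the entry needs no
      -- update.
      have := mt (hm x hx k hk).2 (not_not.2 hb)
      rw [warshallBefore_col] at this
      refine HasMatrix.congr (P := WarshallBefore R k x y) (by simpa using hm) fun i _ j _ => ?_
      rw [warshallBefore_succ]
      exact (or_iff_left fun h' => this h'.2.1).symm
  · refine ⟨by simpa using h₆, ?_, by simpa using hr, by simpa using h₇, by simpa using h₅, ?_⟩
    · iterate 6 refine HasTable.setReg ?_ (by omega)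
      exact h
    · simp [Test.Holds, h₆, h₇, hr k hk, h.zero] at hb
      have := mt (hm k hk y hy).2 (not_not.2 hb)
      rw [warshallBefore_row] at this
      refine HasMatrix.congr (P := WarshallBefore R k x y) (by simpa using hm) fun i _ j _ => ?_
      rw [warshallBefore_succ]
      exact (or_iff_left fun h' => this h'.2.2).symm
  · refine ⟨by simpa using h₆, ?_, ?_, by simpa using h₇, by simpa using h₅, ?_⟩
    · refine HasTable.setArr ?_ (by omega)
      iterate 7 refine HasTable.setReg ?_ (by omega)
      exact h
    · exact HasRows.setArr (by simpa using hr) (by omega)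
    · simp [Test.Holds, h₅, h₇, hr x hx, h.zero] at hb₁
      simp [Test.Holds, h₆, h₇, hr k hk, h.zero] at hb₂
      have h₁ := (hm x hx k hk).1 hb₁
      have h₂ := (hm k hk y hy).1 hb₂
      rw [warshallBefore_col] at h₁
      rw [warshallBefore_row] at h₂
      have hset := hm.setArr (x := x) (c := 1) hy one_ne_zero
      simp only [State.reg_setReg, State.arr_setReg]
      simp only [Nat.reduceEqDiff, if_false, if_true, h₅, h₆, hr x hx, h.one]
      refine HasMatrix.congr hset fun i _ j _ => ?_
      rw [warshallBefore_succ]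
      tauto

theorem runs_warshall {s : State} {R : ℕ → ℕ → Prop} (h : HasTable α M A B L N s)
    (hr : HasRows M s) (hm : HasMatrix M R s) :
    Runs (forProg 7 (forProg 5 (forProg 6 warshallBody))) s
      (forTime M (forTime M (forTime M 10)))
      (fun s' => HasTable α M A B L N s' ∧ HasRows M s' ∧ HasMatrix M (Warshall R M) s') := by
  refine Runs.forProg (M := M) (fun k s => HasTable α M A B L N s ∧ HasRows M s ∧
    HasMatrix M (Warshall R k) s) ?_ ?_ ?_ ?_ ?_
  · rintro k s ⟨h, -⟩
    exact ⟨h.one, h.size⟩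
  · rintro k s c ⟨h, hr, hm⟩
    exact ⟨h.setReg (by omega), hr, hm⟩
  · rintro k hk s ⟨h, hr, hm⟩ h₇
    refine Runs.forProg (M := M) (fun x s => HasTable α M A B L N s ∧ HasRows M s ∧
      s.reg 7 = k ∧ HasMatrix M (WarshallBefore R k x 0) s) ?_ ?_ ?_ ?_ ?_
    · rintro x s ⟨h, -⟩
      exact ⟨h.one, h.size⟩
    · rintro x s c ⟨h, hr, h₇, hm⟩
      exact ⟨h.setReg (by omega), hr, by simpa using h₇, hm⟩
    · rintro x hx s ⟨h, hr, h₇, hm⟩ h₅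
      refine Runs.forProg (M := M) (fun y s => HasTable α M A B L N s ∧ HasRows M s ∧
        s.reg 7 = k ∧ s.reg 5 = x ∧ HasMatrix M (WarshallBefore R k x y) s) ?_ ?_ ?_ ?_ ?_
      · rintro y s ⟨h, -⟩
        exact ⟨h.one, h.size⟩
      · rintro y s c ⟨h, hr, h₇, h₅, hm⟩
        exact ⟨h.setReg (by omega), hr, by simpa using h₇, by simpa using h₅, hm⟩
      · rintro y hy s ⟨h, hr, h₇, h₅, hm⟩ h₆
        exact runs_warshallBody hk hx hy h hr h₇ h₅ h₆ hm
      · exact ⟨h, hr, h₇, h₅, hm⟩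
      · rintro s ⟨h, hr, h₇, h₅, hm⟩
        refine ⟨h₅, h, hr, h₇, hm.congr fun i _ j hj => ?_⟩
        have : (i < x ∨ (i = x ∧ j < M)) ↔ (i < x + 1 ∨ (i = x + 1 ∧ j < 0)) := by omega
        simp only [WarshallBefore, this]
    · refine ⟨h, hr, h₇, hm.congr fun i _ j _ => ?_⟩
      simp [WarshallBefore]
    · rintro s ⟨h, hr, h₇, hm⟩
      refine ⟨h₇, h, hr, hm.congr fun i hi j _ => ?_⟩
      simp only [WarshallBefore, hi, true_or, true_and, Warshall]
      tauto
  · exact ⟨h, hr, hm⟩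
  · exact fun s => id

theorem runs_check {s : State} {R : ℕ → ℕ → Prop} (hN : ∀ x < M, N x < M)
    (h : HasTable α M A B L N s) (hr : HasRows M s) (hm : HasMatrix M R s) (h₀ : s.reg 0 = 1) :
    Runs (forProg 5 checkBody) s (forTime M 10) (fun s' =>
      ((∀ x < M, ¬ (R x (N x) ∧ R (N x) x)) → s'.reg 0 = 1) ∧
      (¬ (∀ x < M, ¬ (R x (N x) ∧ R (N x) x)) → s'.reg 0 = 0)) := by
  refine Runs.forProg (M := M) (fun i s => HasTable α M A B L N s ∧ HasRows M s ∧
    HasMatrix M R s ∧ ((∀ x < i, ¬ (R x (N x) ∧ R (N x) x)) → s.reg 0 = 1) ∧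
      (¬ (∀ x < i, ¬ (R x (N x) ∧ R (N x) x)) → s.reg 0 = 0)) ?_ ?_ ?_ ?_ ?_
  · rintro x s ⟨h, -⟩
    exact ⟨h.one, h.size⟩
  · rintro x s c ⟨h, hr, hm, h₀⟩
    exact ⟨h.setReg (by omega), hr, hm, by simpa using h₀⟩
  · rintro x hx s ⟨h, hr, hm, h₀⟩ h₅
    have hsucc : (∀ g < x + 1, ¬ (R g (N g) ∧ R (N g) g)) ↔
        (∀ g < x, ¬ (R g (N g) ∧ R (N g) g)) ∧ ¬ (R x (N x) ∧ R (N x) x) := by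
      simp only [Nat.lt_succ_iff_lt_or_eq, or_imp, forall_and, forall_eq]
    have hx' := hN x hx
    have h₁ := hm x hx _ hx'
    have h₂ := hm _ hx' x hx
    refine Runs.load_seq (Runs.load_seq (Runs.load_seq (Runs.add_seq (Runs.add_seq (Runs.load_seq
      (Runs.load_seq (t := 3) ?_))))))
    simp only [State.reg_setReg, State.arr_setReg]
    simp only [Nat.reduceEqDiff, if_false, if_true, h₅, hr x hx, h.neg x hx, hr _ hx']
    generalize hs' : State.setReg _ 9 (s.arr 6 _) = s'
    have ht' : HasTable α M A B L N s' := by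
      rw [← hs']
      iterate 7 refine HasTable.setReg ?_ (by omega)
      exact h
    have hr' : HasRows M s' := by rw [← hs']; exact hr
    have hm' : HasMatrix M R s' := by rw [← hs']; exact hm
    have r₀ : s'.reg 0 = s.reg 0 := by simp [← hs']
    have r₅ : s'.reg 5 = x := by simp [← hs', h₅]
    have r₉ : s'.reg 9 = s.arr 6 (N x * M + x) := by simp [← hs']
    have r₁₀ : s'.reg 10 = s.arr 6 (x * M + N x) := by simp [← hs']
    refine Runs.ite (fun hb => Runs.skip (t := 1) ?_) fun hb₁ =>
      Runs.ite (fun hb => Runs.skip (t := 0) ?_) fun hb₂ => Runs.const (t := 0) ?_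
    · simp [Test.Holds, r₁₀, ht'.zero] at hb
      refine ⟨r₅, ht', hr', hm', ?_⟩
      rw [hsucc, r₀]
      tauto
    · simp [Test.Holds, r₉, ht'.zero] at hb
      refine ⟨r₅, ht', hr', hm', ?_⟩
      rw [hsucc, r₀]
      tauto
    · simp [Test.Holds, r₁₀, ht'.zero] at hb₁
      simp [Test.Holds, r₉, ht'.zero] at hb₂
      refine ⟨by simpa using r₅, ht'.setReg (by omega), hr', hm', ?_⟩
      rw [hsucc]
      have h₁ := h₁.1 hb₁
      have h₂ := h₂.1 hb₂
      simp [h₁, h₂]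
  · exact ⟨h, hr, hm, fun _ => h₀, fun h => absurd (by simp) h⟩
  · rintro s ⟨-, -, -, h⟩
    exact h

/-- After `e` rounds the table holds `2 * e` literals; the next round writes only at `2 * e` and `2
* e + 1`. The `17` is the sixteen instructions of the body plus the test. -/
theorem runs_read {l : List ℕ} {m : ℕ} (hl : l.length = 3 * m + 1) {s : State}
    (h₀ : s.reg 0 = l.length) (h₁ : s.reg 1 = 1) (h₂ : s.reg 2 = 0) (h₃ : s.reg 3 = 0)
    (h₄ : s.reg 4 = α.offset) (h₈ : s.reg 8 = 1) (hin : ∀ i, s.arr 0 i = l.getD i 0)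
    (h₆ : ∀ i, s.arr 6 i = 0) :
    Runs (.loop (.lt 8 0) readBody) s (m * 17 + 1) (fun s' =>
      HasTable α (2 * m) (inputTail l) (inputHead l) (inputLabel l) flipLit s' ∧
        ∀ i, s'.arr 6 i = 0) := by
  refine (Runs.loop (t := 16) m (fun e s =>
    HasTable α (2 * e) (inputTail l) (inputHead l) (inputLabel l) flipLit s ∧
      s.reg 0 = l.length ∧ s.reg 8 = 3 * e + 1 ∧ (∀ i, s.arr 0 i = l.getD i 0) ∧
      ∀ i, s.arr 6 i = 0) ?_ ?_ ?_).mono le_rfl ?_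
  · rintro e he s ⟨h, h₀, h₈, hin, h₆⟩
    refine ⟨?_, ?_⟩
    · simp only [Test.Holds]
      omega
    · iterate 7
        first
          | refine Runs.load_seq ?_
          | refine Runs.add_seq ?_
        try simp only [State.reg_setReg, State.arr_setReg]
        simp only [Nat.reduceEqDiff, if_false, if_true,
          h₈, h.one, h.size, hin, add_assoc, Nat.reduceAdd]
      generalize hs' : State.setReg _ 9 _ = s'
      have r₀ : s'.reg 0 = l.length := by simp [← hs', h₀]
      have r₁ : s'.reg 1 = 1 := by simp [← hs', h.one]
      have r₂ : s'.reg 2 = 0 := by simp [← hs', h.zero]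
      have r₃ : s'.reg 3 = 2 * e := by simp [← hs', h.size]
      have r₄ : s'.reg 4 = α.offset := by simp [← hs', h.offset]
      have r₈ : s'.reg 8 = 3 * e + 4 := by simp [← hs']
      have r₉ : s'.reg 9 = 2 * e + 1 := by simp [← hs']
      have r₁₀ : s'.reg 10 = l.getD (3 * e + 1) 0 := by simp [← hs']
      have r₁₁ : s'.reg 11 = l.getD (3 * e + 2) 0 := by simp [← hs']
      have r₁₂ : s'.reg 12 = l.getD (3 * e + 3) 0 := by simp [← hs']
      have harr : s'.arr = s.arr := by simp [← hs']
      clear hs'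
      iterate 8
        refine Runs.store_seq ?_
        simp only [State.reg_setArr, r₃, r₉, r₁₀, r₁₁, r₁₂]
      refine Runs.add (t := 0) ?_
      simp only [State.reg_setArr, r₁, r₉]
      have e₂ : (2 * e + 1) % 2 = 1 := by omega
      have e₃ : (2 * e + 1) / 2 = e := by omega
      have e₄ : 2 * e / 2 = e := by omega
      have hcases : ∀ x < 2 * (e + 1), x = 2 * e ∨ x = 2 * e + 1 ∨
          (x < 2 * e ∧ x ≠ 2 * e ∧ x ≠ 2 * e + 1) := by omega
      refine ⟨⟨?_, ?_, ?_, ?_, fun x hx => ?_, fun x hx => ?_, fun x hx => ?_, fun x hx => ?_⟩,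
        ?_, ?_, fun i => ?_, fun i => ?_⟩
      all_goals simp only [State.reg_setReg, State.reg_setArr, State.arr_setReg, State.arr_setArr,
        harr]
      · simpa using r₁
      · simpa using r₂
      · simp
        ring
      · simpa using r₄
      · rcases hcases x hx with rfl | rfl | ⟨hx, hx₁, hx₂⟩
        · simp [inputTail, e₄]
        · simp [inputTail, e₂, e₃]
        · simp [hx₁, hx₂, h.tail x hx]
      · rcases hcases x hx with rfl | rfl | ⟨hx, hx₁, hx₂⟩
        · simp [inputHead, e₄]
        · simp [inputHead, e₂, e₃]
        · simp [hx₁, hx₂, h.head x hx]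
      · rcases hcases x hx with rfl | rfl | ⟨hx, hx₁, hx₂⟩
        · simp [inputLabel, e₄]
        · simp [inputLabel, e₃]
        · simp [hx₁, hx₂, h.label x hx]
      · rcases hcases x hx with rfl | rfl | ⟨hx, hx₁, hx₂⟩
        · simp [flipLit]
        · simp [flipLit, e₂]
        · simp [hx₁, hx₂, h.neg x hx]
      · simpa using r₀
      · simp [r₈]
        ring
      · simp [hin]
      · simp [h₆]
  · rintro s ⟨-, h₀, h₈, -⟩
    simp only [Test.Holds]
    omega
  · exact ⟨⟨h₁, h₂, h₃, h₄, by simp, by simp, by simp, by simp⟩, h₀, by simpa using h₈, hin, h₆⟩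
  · rintro s ⟨h, -, -, -, h₆⟩
    exact ⟨h, h₆⟩

end Parts

/-! ### The running time -/

def decideTime (m M : ℕ) : ℕ :=
  (m * 17 + 1 + ((forTime M 2 + (forTime M (forTime M (clauseTime M)) +
    (forTime M (forTime M (forTime M 10)) + (forTime M 10 + 1)))) + 1)) + 3

open Polynomial in
-- `forTime` is polynomial and monotone in both arguments, so nested loops amount to composing the
-- operator `g`.
theorem exists_polynomial_decideTime :
    ∃ f : Polynomial ℕ, ∀ m M n, m ≤ n → M ≤ n → decideTime m M ≤ f.eval n := by
  let g : Polynomial ℕ → Polynomial ℕ := fun t => X * (t + 2) + 2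
  have hg : ∀ t n, (g t).eval n = forTime n (t.eval n) := by
    intro t n
    simp [g, forTime]
  let c : Polynomial ℕ := 7 + (3 + (1 + (g 7 + 9)))
  have hc : ∀ n, c.eval n = clauseTime n := by
    intro n
    simp [c, hg, clauseTime]
  refine ⟨(X * 17 + 1 + ((g 2 + (g (g c) + (g (g (g 10)) + (g 10 + 1)))) + 1)) + 3, ?_⟩
  intro m M n hm hM
  have mono : ∀ {t t' : ℕ}, t ≤ t' → forTime M t ≤ forTime n t' := by
    intro t t' h
    unfold forTime
    gcongr
  have monoC : clauseTime M ≤ clauseTime n := by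
    have := mono (le_refl 7)
    unfold clauseTime
    omega
  have h₁ := mono (le_refl 2)
  have h₂ := mono (mono monoC)
  have h₃ := mono (mono (mono (le_refl 10)))
  have h₄ := mono (le_refl 10)
  simp only [eval_add, eval_mul, eval_X, hg, hc, eval_ofNat, eval_one]
  unfold decideTime
  omega

theorem length_le_inputSize (l : List ℕ) : l.length ≤ inputSize l := by
  induction l with
  | nil => simp [inputSize]
  | cons a l ih =>
    simp only [inputSize, List.map_cons, List.sum_cons, List.length_cons] at ih ⊢
    omega

/-! ### Assembly of the decision procedure -/

theorem runs_decideProg (α : Variant) {n : ℕ} {T : TemporalGraph (Fin n)} {l : List ℕ} {m : ℕ}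
    (hl : l.length = 3 * m + 1)
    (h : IsLiteralTable T (2 * m) (inputTail l) (inputHead l) (inputLabel l) flipLit) :
    Runs (decideProg α) (init l) (decideTime m (2 * m)) (fun s =>
      (StrongTTO α ⟨n, T⟩ → s.reg 0 = 1) ∧ (¬ StrongTTO α ⟨n, T⟩ → s.reg 0 = 0)) := by
  have hQ : StrongTTO α ⟨n, T⟩ ↔ _ := (h.exists_orientation_iff α).trans
    (exists_assignment_iff_warshall _ h.neg_lt h.neg_neg h.neg_ne)
  rw [hQ]
  refine Runs.const_seq (Runs.const_seq (Runs.const_seq (Runs.seq (runs_read hl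
    (α := α) ?_ ?_ ?_ ?_ ?_ ?_ ?_ ?_) ?_)))
  iterate 6 simp [init]
  · intro i
    simp [init]
  · intro i
    simp [init]
  rintro s ⟨ht, h₆⟩
  refine Runs.const_seq (Runs.seq (runs_rows (ht.setReg (by omega)) (by simp) (by simpa using h₆))
    ?_)
  rintro s ⟨ht, hr, h₆⟩
  refine Runs.seq (runs_clauses h.neg_lt ht hr h₆) ?_
  rintro s ⟨ht, hr, hm⟩
  refine Runs.seq (runs_warshall ht hr hm) ?_
  rintro s ⟨ht, hr, hm⟩
  exact Runs.const_seq (runs_check h.neg_lt (ht.setReg (by omega)) hr hm (by simp))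

theorem solvableInPolyTime_strongTTO (α : Variant) :
    SolvableInPolyTime EncodesInstance (StrongTTO α) := by
  obtain ⟨f, hf⟩ := exists_polynomial_decideTime
  refine ⟨decideProg α, f, ?_⟩
  rintro ⟨n, T⟩ l hl
  obtain ⟨m, hlen, htab⟩ := hl.isLiteralTable
  obtain ⟨k, s, hex, hk, h⟩ := runs_decideProg α hlen htab
  have := length_le_inputSize l
  -- Both `m` and `2 * m` are at most `3 * m + 1`, the length of the input.
  exact ⟨k, s, hex, hk.trans (hf _ _ _ (by omega) (by omega)), h⟩

end RAM

theorem mainTheorem4 :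
    RAM.SolvableInPolyTime EncodesInstance (StrongTTO .strong) ∧
    RAM.SolvableInPolyTime EncodesInstance (StrongTTO .strongStrict) ∧
    ∀ (α : Variant) (V : Type*) [Finite V] (T : TemporalGraph V),
      (∀ u v w : V, T.graph.Adj u v → T.graph.Adj v w → u ≠ w →
        ∃ ψ : TwoCNF (V × V), ψ.VarsIn (({u, v, w} : Set V) ×ˢ ({u, v, w} : Set V)) ∧
          ∀ F : Set (V × V), T.IsProperOrientation F →
            (ψ.Sat (fun e => e ∈ F) ↔ T.StronglyTransitiveOn α F {u, v, w})) ∧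
      ∃ φ : TwoCNF (V × V), ∀ F : Set (V × V),
        φ.Sat (fun e => e ∈ F) ↔ T.IsStrongOrientation α F := by
  exact ⟨RAM.solvableInPolyTime_strongTTO _, RAM.solvableInPolyTime_strongTTO _,
    fun α _ _ T => ⟨fun _ _ _ _ _ _ => T.exists_twoCNF_transitiveOn α _,
      T.exists_twoCNF_strongOrientation α⟩⟩
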